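/- Let $0<\beta\le 1$ and $0<\nu\le 1$. Let $B$ be a standard Brownian motion on $\mathbb R$, $H^\beta$ a stable subordinator of order $\beta$ and $H^\nu$ a stable subordinator of order $\nu$ (nondecreasing right-continuous paths from $0$, independent stationary increments, $\mathbb E\,e^{-\gamma H^\alpha(t)}=e^{-t\gamma^\alpha}$ for $\gamma\ge 0$), the three processes being independent. Let $\mathfrak B(t)=B(t)\bmod 2\pi\in[0,2\pi)$ be circular Brownian motion, $L^\nu(t)=\inf\{s>0: H^\nu(s)\ge t\}$, and $E_{\nu,1}(x)=\sum_{j\ge 0}x^j/\Gamma(\nu j+1)$. (i) For $t>0$ and $\theta\in(0,2\pi)$ (and also for $\theta=0$ if $\nu=1$ or $\beta>\tfrac12$) the series $$p(\theta,t)=\frac1{2\pi}+\frac1\pi\sum_{k=1}^\infty E_{\nu,1}\!\left(-\Big(\frac{k^2}{2}\Big)^{\beta}t^\nu\right)\cos k\theta$$ converges, as the limit of its partial sums in the natural order, and $p(\theta,t)\ge 0$. (ii) For every $t>0$ the law of $\mathfrak B\big(H^\beta(L^\nu(t))\big)$ on $[0,2\pi)$ has density $p(\cdot,t)$ with respect to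 Lebesgue measure. (iii) $p$ solves on the circle the Cauchy problem $$\frac{\partial^\nu}{\partial t^\nu}p(\theta,t)=-\Big(-\frac12\frac{\partial^2}{\partial\theta^2}\Big)^{\beta}p(\theta,t),\quad t>0,\qquad p(\theta,0)=\delta(\theta),$$ in the sense of distributions in $\theta$: $p(\cdot,t)$ is integrable on $[0,2\pi]$ for $t>0$, and for every $2\pi$-periodic $\varphi\in C^\infty(\mathbb R)$ the function $u(t)=\int_0^{2\pi}\varphi(\theta)p(\theta,t)\,d\theta$ satisfies $u(t)\to\varphi(0)$ as $t\downarrow 0$ and $$\frac{d^\nu u}{dt^\nu}(t)=-\int_0^{2\pi}\big(A^\beta\varphi\big)(\theta)\,p(\theta,t)\,d\theta ,\qquad t>0,\qquad A=-\frac12\frac{d^2}{d\theta^2}.$$ Here $\frac{d^\nu u}{dt^\nu}(t)=\frac1{\Gamma(1-\nu)}\int_0^t\frac{u'(s)}{(t-s)^\nu}\,ds$ is the Caputo derivative for $0<\nu<1$ ($u$ being differentiable on $(0,\infty)$ and the integral absolutely convergent), and $\frac{du}{dt}$ for $\nu=1$; and $A^\beta\varphi=\frac{\sin\pi\beta}{\pi}\int_0^\infty\lambda^{\beta-1}(\lambda+A)^{-1}A\varphi\,d\lambda$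 for $0<\beta<1$, with $A^1=A$. -/

import Mathlib

open MeasureTheory ProbabilityTheory Set Filter Topology
open scoped NNReal ENNReal

namespace CircleFrac

noncomputable section

/-- The Mittag-Leffler function `E_{ν,1}(x) = ∑_{j ≥ 0} x ^ j / Γ(ν j + 1)`
(absolutely convergent for every real `x` when `ν > 0`). -/
def mittagLeffler (ν x : ℝ) : ℝ :=
  ∑' j : ℕ, x ^ j / Real.Gamma (ν * j + 1)

/-- `H` is a stable subordinator of order `α`: a process starting at `0`, with independent and
stationary increments, whose increments have Laplace transform
`E exp (-γ (H t - H s)) = exp (-(t - s) γ ^ α)`, and whose paths are almost surely nondecreasing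
and right-continuous. For `α = 1` this is `H t = t`. -/
structure IsStableSubordinator {Ω : Type*} [MeasurableSpace Ω] (α : ℝ) (H : ℝ≥0 → Ω → ℝ≥0)
    (P : Measure Ω) : Prop where
  measurable : ∀ t, Measurable (H t)
  zero : ∀ᵐ ω ∂P, H 0 ω = 0
  indep : HasIndepIncrements (fun t ω => (H t ω : ℝ)) P
  laplace : ∀ s t : ℝ≥0, s ≤ t → ∀ γ : ℝ, 0 ≤ γ →
    ∫ ω, Real.exp (-(γ * ((H t ω : ℝ) - H s ω))) ∂P = Real.exp (-(((t : ℝ) - s) * γ ^ α))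
  mono : ∀ᵐ ω ∂P, Monotone fun t => H t ω
  rightCont : ∀ᵐ ω ∂P, ∀ t, ContinuousWithinAt (fun s => H s ω) (Ici t) t

/-- The inverse `L t = inf {s > 0 : H s ≥ t}` of a subordinator. (For a stable subordinator the set
is almost surely nonempty, since `H s → ∞` as `s → ∞` almost surely.) -/
def inverseSubordinator {Ω : Type*} (H : ℝ≥0 → Ω → ℝ≥0) (t : ℝ≥0) (ω : Ω) : ℝ≥0 :=
  sInf {s : ℝ≥0 | 0 < s ∧ t ≤ H s ω}

/-- The motion on the unit circle obtained by wrapping up a motion `B` on the line; points of the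
circle are given by their angle in `[0, 2π)`. -/
def wrap {Ω : Type*} (B : ℝ≥0 → Ω → ℝ) (t : ℝ≥0) (ω : Ω) : ℝ :=
  toIcoMod Real.two_pi_pos 0 (B t ω)

/-- Partial sums of the Fourier series
`1/(2π) + (1/π) ∑_{k ≥ 1} E_{ν,1}(-(k²/2)^β t^ν) cos (k θ)`. -/
def densityPartialSum (ν β θ t : ℝ) (N : ℕ) : ℝ :=
  1 / (2 * Real.pi) + 1 / Real.pi * ∑ k ∈ Finset.Icc 1 N,
    mittagLeffler ν (-(((k : ℝ) ^ 2 / 2) ^ β * t ^ ν)) * Real.cos (k * θ)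

/-- The sum of the Fourier series, as the limit of its partial sums (the convergence is only
conditional in general). -/
def density (ν β θ t : ℝ) : ℝ :=
  limUnder atTop (densityPartialSum ν β θ t)

/-- The resolvent `(μ + A)⁻¹`, `μ > 0`, of `A = -(1/2) ∂²/∂θ²` on bounded continuous
(in particular on `2π`-periodic continuous) functions: `(μ + A)⁻¹ f` is the bounded solution `u` of
`μ u - u'' / 2 = f`, given by its Green kernel. -/
def greenResolvent (μ : ℝ) (f : ℝ → ℝ) (θ : ℝ) : ℝ :=
  1 / √(2 * μ) * ∫ y, Real.exp (-(√(2 * μ) * |θ - y|)) * f y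

/-- The operator `A = -(1/2) ∂²/∂θ²`. -/
def halfNegLaplacian (f : ℝ → ℝ) (θ : ℝ) : ℝ :=
  -(1 / 2) * iteratedDeriv 2 f θ

/-- The fractional power `(-(1/2) ∂²/∂θ²)^β`, `0 < β ≤ 1`, through the Bochner-Balakrishnan formula
`A^β f = (sin (π β) / π) ∫₀^∞ μ^(β - 1) (μ + A)⁻¹ A f dμ` for `0 < β < 1`, and `A` itself
for `β = 1`. -/
def fracPower (β : ℝ) (f : ℝ → ℝ) (θ : ℝ) : ℝ :=
  if β = 1 then halfNegLaplacian f θ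
  else Real.sin (Real.pi * β) / Real.pi *
    ∫ μ in Ioi (0 : ℝ), μ ^ (β - 1) * greenResolvent μ (halfNegLaplacian f) θ

/-- `u` has at time `t > 0` the Caputo derivative `d` of order `ν ∈ (0, 1]`; for `ν = 1` this is the
ordinary derivative, and for `0 < ν < 1` it is
`d = (1 / Γ(1 - ν)) ∫₀ᵗ u'(s) / (t - s)^ν ds`, the integral being absolutely convergent. -/
def HasCaputoDeriv (ν : ℝ) (u : ℝ → ℝ) (t d : ℝ) : Prop :=
  if ν = 1 then HasDerivAt u d t
  else (∀ s ∈ Ioo 0 t, DifferentiableAt ℝ u s) ∧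
    IntervalIntegrable (fun s => deriv u s / (t - s) ^ ν) volume 0 t ∧
    d = 1 / Real.Gamma (1 - ν) * ∫ s in (0 : ℝ)..t, deriv u s / (t - s) ^ ν

/-- The pairing `∫₀^{2π} φ(θ) p(θ, t) dθ`. -/
def pairing (p : ℝ → ℝ → ℝ) (φ : ℝ → ℝ) (t : ℝ) : ℝ :=
  ∫ θ in (0 : ℝ)..(2 * Real.pi), φ θ * p θ t

/-- `p(θ, t)` solves on the circle the Cauchy problem
`∂^ν p / ∂t^ν = -(-(1/2) ∂²/∂θ²)^β p` for `t > 0`, `p(θ, 0) = δ(θ)`, in the sense of distributions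
in the space variable: for every smooth function `φ` on the circle the function `⟨φ, p(·, t)⟩`
has Caputo derivative `-⟨(-(1/2) ∂²/∂θ²)^β φ, p(·, t)⟩` at every `t > 0`, and it tends
to `φ(0)` as `t → 0+`. -/
def SolvesCauchyProblem (ν β : ℝ) (p : ℝ → ℝ → ℝ) : Prop :=
  (∀ t, 0 < t → IntervalIntegrable (fun θ => p θ t) volume 0 (2 * Real.pi)) ∧
  ∀ φ : ℝ → ℝ, ContDiff ℝ (⊤ : ℕ∞) φ → Function.Periodic φ (2 * Real.pi) →
    (∀ t, 0 < t → HasCaputoDeriv ν (pairing p φ) t (-pairing p (fracPower β φ) t)) ∧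
    Tendsto (pairing p φ) (𝓝[>] 0) (𝓝 (φ 0))

end

end CircleFrac

/-! Write `T = H (L t)`. It is independent of `B` and almost surely positive, and given `T` the
wrapped motion has the wrapped Gaussian density of variance `T`. Poisson summation turns this
density into the theta series with coefficients `exp (-k²T/2)` (`hasSum_exp_mul_cos`,
`lintegral_wrap_gaussianReal`). Averaging over `T` replaces `exp (-γT)`, `γ = k²/2`, by `E_ν(-γ^β
t^ν)`: conditioning on `L t` leaves `E exp (-γ^β L t)`, and `L t` has the law of `t^ν K₁^(-ν)`
because `{L t ≤ s} = {K_s ≥ t}` and `K` is self-similar (`map_pathInverse`). The moments of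
`K₁^(-ν)` are `n!/Γ(νn+1)`, so its Laplace transform is the Mittag-Leffler series
(`integral_exp_neg_mul_rpow_neg`).

The delicate point is the exchange of sum and average, since the coefficients need not be summable.
For `θ` in `(0, 2π)`, Abel summation and Dirichlet's bound control the partial sums of the theta
series uniformly in their length and in the variance (`abs_thetaPartialSum_le`), so dominated
convergence applies, and nonnegativity is inherited from the Gaussian. At `θ = 0` there is no
cancellation and the coefficients have to be summable: they are exponentials when `ν = 1`, and when
`β > 1/2` the bound `E_ν(-x) = O(1/x)` suffices (`mittagLeffler_neg_le`).

For the Cauchy problem, a test function is expanded as `∑ r_k cos (kθ + δ_k)` with rapidly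
decreasing `r_k`, and its pairing with the law is `∑ r_k cos δ_k E_ν(-l_k t^ν)`, `l_k = (k²/2)^β`.
Each `E_ν(-l t^ν)` is an eigenfunction of the Caputo derivative with eigenvalue `-l`, by a Beta
integral (`integral_deriv_mittagLeffler`), while the Balakrishnan integral multiplies the `k`-th
mode by `l_k` (`fracPower_tsum_cos`). A bound `C l s^(ν-1)` for the derivative of `E_ν(-l s^ν)`,
with `∑ r_k l_k` finite, justifies working termwise (`hasCaputoDeriv_tsum_mittagLeffler`). -/

namespace CircleFrac

/-! ### The Mittag-Leffler series and its Caputo derivative -/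

/-- A lower bound for the Gamma function which beats every geometric sequence. -/
lemma exp_neg_mul_rpow_le_Gamma {R a : ℝ} (hR : 0 < R) (ha : 0 ≤ a) :
    Real.exp (-R) * R ^ a ≤ Real.Gamma (a + 1) := by
  rw [Real.Gamma_eq_integral (by linarith)]
  simp only [add_sub_cancel_right]
  have hint : IntegrableOn (fun x : ℝ => Real.exp (-x) * x ^ a) (Ioi 0) := by
    simpa using Real.GammaIntegral_convergent (s := a + 1) (by linarith)
  have h1 : ∫ x in Ioi R, Real.exp (-x) * R ^ a ≤ ∫ x in Ioi R, Real.exp (-x) * x ^ a := by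
    refine setIntegral_mono_on ?_ (hint.mono_set (Ioi_subset_Ioi hR.le)) measurableSet_Ioi ?_
    · exact (integrableOn_exp_neg_Ioi R).mul_const _
    · intro x hx
      have := hx.out.le
      gcongr
  calc Real.exp (-R) * R ^ a = ∫ x in Ioi R, Real.exp (-x) * R ^ a := by
        rw [integral_mul_const, integral_exp_neg_Ioi]
    _ ≤ _ := h1
    _ ≤ _ := setIntegral_mono_set hint
        ((ae_restrict_iff' measurableSet_Ioi).2 (ae_of_all _ fun x hx => by
          have := hx.out.le; simp only [Pi.zero_apply]; positivity))
        (Ioi_subset_Ioi hR.le).eventuallyLE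

lemma mittagLeffler_arg_nonneg {ν : ℝ} (hν : 0 < ν) (j : ℕ) : 0 ≤ ν * j := by positivity

lemma Gamma_mul_add_one_pos {ν : ℝ} (hν : 0 < ν) (j : ℕ) : 0 < Real.Gamma (ν * j + 1) :=
  Real.Gamma_pos_of_pos (by positivity)

lemma summable_abs_mittagLeffler {ν : ℝ} (hν : 0 < ν) (x : ℝ) :
    Summable fun j : ℕ => |x| ^ j / Real.Gamma (ν * j + 1) := by
  -- Chosen so that `R ^ (ν j) = (2|x| + 1) ^ j`: the Gamma bound then makes the `j`-th term at most
  -- `exp R / 2 ^ j`. The `+ 1` keeps `R` positive at `x = 0`.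
  set R : ℝ := (2 * |x| + 1) ^ ν⁻¹
  have hR : 0 < R := by positivity
  have hRν : R ^ ν = 2 * |x| + 1 := by
    rw [← Real.rpow_mul (by positivity), inv_mul_cancel₀ hν.ne', Real.rpow_one]
  have hgeo : Summable fun j : ℕ => Real.exp R * (1 / 2 : ℝ) ^ j :=
    (summable_geometric_of_lt_one (by norm_num) (by norm_num)).mul_left _
  refine Summable.of_nonneg_of_le (fun j => ?_) (fun j => ?_) hgeo
  · have := Gamma_mul_add_one_pos hν j
    positivity
  · have h := exp_neg_mul_rpow_le_Gamma hR (mittagLeffler_arg_nonneg hν j)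
    rw [Real.rpow_mul hR.le, hRν, Real.rpow_natCast] at h
    rw [div_le_iff₀ (Gamma_mul_add_one_pos hν j)]
    calc |x| ^ j = Real.exp R * (1 / 2) ^ j * (Real.exp (-R) * (2 * |x|) ^ j) := by
          rw [Real.exp_neg, mul_pow, div_pow]
          field_simp
          simp
      _ ≤ Real.exp R * (1 / 2) ^ j * (Real.exp (-R) * (2 * |x| + 1) ^ j) := by
          gcongr; linarith
      _ ≤ _ := by gcongr

lemma summable_mittagLeffler {ν : ℝ} (hν : 0 < ν) (x : ℝ) :
    Summable fun j : ℕ => x ^ j / Real.Gamma (ν * j + 1) := by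
  refine Summable.of_norm ?_
  convert summable_abs_mittagLeffler hν x using 2 with j
  rw [norm_div, norm_pow, Real.norm_eq_abs, Real.norm_of_nonneg (Gamma_mul_add_one_pos hν j).le]

lemma mittagLeffler_zero (ν : ℝ) : mittagLeffler ν 0 = 1 := by
  rw [mittagLeffler, tsum_eq_single 0]
  · simp
  · intro j hj; simp [hj]

lemma mittagLeffler_one (x : ℝ) : mittagLeffler 1 x = Real.exp x := by
  rw [mittagLeffler, Real.exp_eq_exp_ℝ, NormedSpace.exp_eq_tsum_div]
  simp [Real.Gamma_nat_eq_factorial]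

/-- The derivative of the Mittag-Leffler function, as a power series. -/
lemma hasDerivAt_mittagLeffler {ν : ℝ} (hν : 0 < ν) (x : ℝ) :
    HasDerivAt (mittagLeffler ν)
      (∑' j : ℕ, x ^ j / (ν * Real.Gamma (ν * (j + 1 : ℕ)))) x := by
  have hR : 1 ≤ |x| + 1 := by linarith [abs_nonneg x]
  -- The doubled radius absorbs the factor `j` produced by differentiation, through `j ≤ 2 ^ j`.
  have hu : Summable fun j : ℕ => |2 * (|x| + 1)| ^ j / Real.Gamma (ν * j + 1) :=
    summable_abs_mittagLeffler hν _
  have hle : ∀ (j : ℕ) (y : ℝ), y ∈ Metric.ball (0 : ℝ) (|x| + 1) →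
      ‖j * y ^ (j - 1) / Real.Gamma (ν * j + 1)‖ ≤
        |2 * (|x| + 1)| ^ j / Real.Gamma (ν * j + 1) := by
    intro j y hy
    have hG := Gamma_mul_add_one_pos hν j
    rw [norm_div, Real.norm_of_nonneg hG.le]
    gcongr
    rw [abs_of_nonneg (by positivity), norm_mul, norm_pow, Real.norm_natCast, mul_pow]
    gcongr
    · exact_mod_cast Nat.lt_two_pow_self.le
    · calc ‖y‖ ^ (j - 1) ≤ (|x| + 1) ^ (j - 1) := by
            gcongr; simpa using (mem_ball_zero_iff.1 hy).le
        _ ≤ (|x| + 1) ^ j := pow_le_pow_right₀ hR (Nat.sub_le _ _)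
  have hx : x ∈ Metric.ball (0 : ℝ) (|x| + 1) := by simp
  have h := hasDerivAt_tsum_of_isPreconnected (𝕜 := ℝ)
    (g := fun (j : ℕ) y => y ^ j / Real.Gamma (ν * j + 1))
    (g' := fun (j : ℕ) y => j * y ^ (j - 1) / Real.Gamma (ν * j + 1))
    hu Metric.isOpen_ball (convex_ball (0 : ℝ) (|x| + 1)).isPreconnected
    (fun j y _ => (hasDerivAt_pow j y).div_const _) hle hx (summable_mittagLeffler hν x) hx
  refine h.congr_deriv (Eq.symm ?_)
  have hs : Summable fun j : ℕ => (j * x ^ (j - 1) / Real.Gamma (ν * j + 1)) :=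
    Summable.of_norm_bounded hu fun j => hle j x hx
  -- The `j = 0` term vanishes; after the shift, `Γ(x + 1) = x Γ(x)` at `x = ν (j + 1)` cancels the
  -- factor `j + 1`.
  rw [hs.tsum_eq_zero_add]
  simp only [CharP.cast_eq_zero, zero_mul, zero_div, zero_add, add_tsub_cancel_right]
  refine tsum_congr fun j => ?_
  have hpos : 0 < ν * (j + 1 : ℕ) := by positivity
  rw [Real.Gamma_add_one hpos.ne']
  have := (Real.Gamma_pos_of_pos hpos).ne'
  have h3 : ((j + 1 : ℕ) : ℝ) ≠ 0 := by positivity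
  field_simp

lemma continuous_mittagLeffler {ν : ℝ} (hν : 0 < ν) : Continuous (mittagLeffler ν) :=
  continuous_iff_continuousAt.2 fun x => (hasDerivAt_mittagLeffler hν x).continuousAt

/-- The real Beta integral on `[0, t]`. -/
lemma integral_rpow_mul_sub_rpow {u v t : ℝ} (hu : 0 < u) (hv : 0 < v) (ht : 0 < t) :
    ∫ s in (0 : ℝ)..t, s ^ (u - 1) * (t - s) ^ (v - 1) =
      t ^ (u + v - 1) * (Real.Gamma u * Real.Gamma v / Real.Gamma (u + v)) := by
  have h := Complex.betaIntegral_scaled (u : ℂ) (v : ℂ) ht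
  rw [Complex.betaIntegral_eq_Gamma_mul_div _ _ (by simpa) (by simpa)] at h
  have h2 : ∫ s in (0 : ℝ)..t, ((s : ℂ) ^ ((u : ℂ) - 1) * ((t : ℂ) - s) ^ ((v : ℂ) - 1)) =
      ∫ s in (0 : ℝ)..t, ((s ^ (u - 1) * (t - s) ^ (v - 1) : ℝ) : ℂ) := by
    refine intervalIntegral.integral_congr fun s hs => ?_
    rw [uIcc_of_le ht.le] at hs
    have h3 : 0 ≤ t - s := by linarith [hs.2]
    simp only [Complex.ofReal_mul, Complex.ofReal_cpow hs.1, Complex.ofReal_cpow h3]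
    push_cast
    rfl
  rw [h2, intervalIntegral.integral_ofReal, ← Complex.ofReal_add, Complex.Gamma_ofReal,
    Complex.Gamma_ofReal, Complex.Gamma_ofReal] at h
  have h4 : ((t : ℂ) ^ (((u + v : ℝ) : ℂ) - 1)) = ((t ^ (u + v - 1) : ℝ) : ℂ) := by
    rw [Complex.ofReal_cpow ht.le]; push_cast; rfl
  rw [h4] at h
  exact_mod_cast h

/-- A non-integrable function has integral `0` by convention, which contradicts the positive value
of the Beta integral. -/
lemma intervalIntegrable_rpow_mul_sub_rpow {u v t : ℝ} (hu : 0 < u) (hv : 0 < v) (ht : 0 < t) :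
    IntervalIntegrable (fun s => s ^ (u - 1) * (t - s) ^ (v - 1)) volume 0 t := by
  by_contra h
  have h1 := integral_rpow_mul_sub_rpow hu hv ht
  rw [intervalIntegral.integral_undef h] at h1
  have := Real.Gamma_pos_of_pos hu
  have := Real.Gamma_pos_of_pos hv
  have := Real.Gamma_pos_of_pos (add_pos hu hv)
  have h2 : 0 < t ^ (u + v - 1) * (Real.Gamma u * Real.Gamma v / Real.Gamma (u + v)) := by
    positivity
  linarith

/-- `s ↦ E_ν(-l s^ν)` is differentiable on `(0, ∞)`. -/
lemma hasDerivAt_mittagLeffler_rpow {ν : ℝ} (hν : 0 < ν) (l : ℝ) {s : ℝ} (hs : 0 < s) :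
    HasDerivAt (fun s => mittagLeffler ν (-(l * s ^ ν)))
      (∑' j : ℕ, (-l) ^ (j + 1) * s ^ (ν * (j + 1 : ℕ) - 1) / Real.Gamma (ν * (j + 1 : ℕ))) s := by
  have h1 : HasDerivAt (fun s : ℝ => -(l * s ^ ν)) (-(l * (ν * s ^ (ν - 1)))) s :=
    ((Real.hasDerivAt_rpow_const (Or.inl hs.ne')).const_mul l).neg
  have h := (hasDerivAt_mittagLeffler hν (-(l * s ^ ν))).comp s h1
  refine h.congr_deriv (Eq.symm ?_)
  rw [← tsum_mul_right]
  refine tsum_congr fun j => ?_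
  have e : s ^ (ν * (j + 1 : ℕ) - 1) = (s ^ ν) ^ j * s ^ (ν - 1) := by
    rw [← Real.rpow_natCast, ← Real.rpow_mul hs.le, ← Real.rpow_add hs]
    congr 1; push_cast; ring
  rw [e]
  have := (Real.Gamma_pos_of_pos (show 0 < ν * (j + 1 : ℕ) by positivity)).ne'
  field_simp
  rw [neg_mul_eq_neg_mul l (s ^ ν), mul_pow]
  ring

/-- The Caputo derivative of `s ↦ E_ν(-l s^ν)`. -/
lemma integral_deriv_mittagLeffler {ν : ℝ} (hν : 0 < ν) (hν1 : ν < 1) {l t : ℝ} (ht : 0 < t) :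
    ∫ s in (0 : ℝ)..t, deriv (fun s => mittagLeffler ν (-(l * s ^ ν))) s / (t - s) ^ ν =
      -(l * Real.Gamma (1 - ν) * mittagLeffler ν (-(l * t ^ ν))) := by
  -- The termwise derivative against the kernel `(t - s) ^ (-ν)`. Its integral is a Beta integral in
  -- which `Γ(ν (j + 1))` cancels and `Γ(ν j + 1)` appears, so the Mittag-Leffler series returns
  -- with one factor `-l` to spare.
  set F : ℕ → ℝ → ℝ := fun j s => (-l) ^ (j + 1) / Real.Gamma (ν * (j + 1 : ℕ)) *
    (s ^ (ν * (j + 1 : ℕ) - 1) * (t - s) ^ ((1 - ν) - 1)) with hF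
  have hpos : ∀ j : ℕ, 0 < ν * (j + 1 : ℕ) := fun j => by positivity
  have hν' : 0 < 1 - ν := by linarith
  have hint : ∀ j, IntegrableOn (F j) (Ioc 0 t) := fun j =>
    (intervalIntegrable_iff_integrableOn_Ioc_of_le ht.le).1
      ((intervalIntegrable_rpow_mul_sub_rpow (hpos j) hν' ht).const_mul _)
  have hval : ∀ j : ℕ, ∫ s in Ioc 0 t, s ^ (ν * (j + 1 : ℕ) - 1) * (t - s) ^ ((1 - ν) - 1) =
      (t ^ ν) ^ j * (Real.Gamma (ν * (j + 1 : ℕ)) * Real.Gamma (1 - ν) /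
        Real.Gamma (ν * j + 1)) := by
    intro j
    rw [← intervalIntegral.integral_of_le ht.le, integral_rpow_mul_sub_rpow (hpos j) hν' ht]
    have e1 : ν * (j + 1 : ℕ) + (1 - ν) = ν * j + 1 := by push_cast; ring
    rw [e1, add_sub_cancel_right, Real.rpow_mul ht.le, Real.rpow_natCast]
  have hnorm : ∀ j, ∫ s in Ioc 0 t, ‖F j s‖ =
      |l| * Real.Gamma (1 - ν) * (|l * t ^ ν| ^ j / Real.Gamma (ν * j + 1)) := by
    intro j
    have hG := Real.Gamma_pos_of_pos (hpos j)
    have : ∀ s ∈ Ioc 0 t, ‖F j s‖ = |l| ^ (j + 1) / Real.Gamma (ν * (j + 1 : ℕ)) *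
        (s ^ (ν * (j + 1 : ℕ) - 1) * (t - s) ^ ((1 - ν) - 1)) := by
      intro s hs
      have h1 : 0 ≤ t - s := by linarith [hs.2]
      have h2 := hs.1.le
      rw [hF]
      simp only [norm_mul, norm_div, norm_pow, norm_neg, Real.norm_eq_abs, abs_of_pos hG]
      rw [abs_of_nonneg (Real.rpow_nonneg h2 _), abs_of_nonneg (Real.rpow_nonneg h1 _)]
    rw [setIntegral_congr_fun measurableSet_Ioc this, integral_const_mul, hval]
    rw [abs_mul, abs_of_pos (Real.rpow_pos_of_pos ht ν), mul_pow]
    field_simp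
    ring
  have hsum := hasSum_integral_of_summable_integral_norm hint
    (by simp_rw [hnorm]; exact (summable_abs_mittagLeffler hν _).mul_left _)
  rw [intervalIntegral.integral_of_le ht.le]
  have e2 : ∫ s in Ioc 0 t, deriv (fun s => mittagLeffler ν (-(l * s ^ ν))) s / (t - s) ^ ν =
      ∫ s in Ioc 0 t, ∑' j, F j s := by
    refine setIntegral_congr_fun measurableSet_Ioc fun s hs => ?_
    rw [(hasDerivAt_mittagLeffler_rpow hν l hs.1).deriv, ← tsum_div_const]
    refine tsum_congr fun j => ?_
    have h1 : 0 ≤ t - s := by linarith [hs.2]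
    simp only [hF, sub_sub_cancel_left]
    rw [Real.rpow_neg h1]
    ring
  rw [e2, ← hsum.tsum_eq, mittagLeffler, ← tsum_mul_left, ← tsum_neg]
  refine tsum_congr fun j => ?_
  simp only [hF]
  rw [integral_const_mul, hval]
  have hG := (Real.Gamma_pos_of_pos (hpos j)).ne'
  field_simp
  rw [neg_mul_eq_neg_mul l (t ^ ν), mul_pow]
  ring

/-! ### Laplace transforms: uniqueness and negative moments -/

section Laplace

/-- Since `exp (-x)` takes values in `[0, 1]`, its characteristic function is the series of its
moments, and these are the values of the Laplace transform of `μ` at the integers. -/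
lemma charFun_map_exp_neg (μ : Measure ℝ) [IsFiniteMeasure μ] (hμ : ∀ᵐ x ∂μ, 0 ≤ x) (t : ℝ) :
    charFun (μ.map fun x => Real.exp (-x)) t =
      ∑' n : ℕ, (t * Complex.I) ^ n / (n.factorial : ℂ) *
        ((∫ x, Real.exp (-(n * x)) ∂μ : ℝ) : ℂ) := by
  rw [charFun_apply_real, integral_map (by fun_prop) (by fun_prop)]
  set F : ℕ → ℝ → ℂ := fun n x =>
    (t * Complex.I) ^ n / (n.factorial : ℂ) * ((Real.exp (-(n * x)) : ℝ) : ℂ) with hF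
  have hint0 : ∀ n : ℕ, Integrable (fun x => Real.exp (-(n * x))) μ := fun n => by
    refine Integrable.of_bound (by fun_prop) 1 ?_
    filter_upwards [hμ] with x hx
    rw [Real.norm_of_nonneg (Real.exp_pos _).le, Real.exp_le_one_iff]
    have : 0 ≤ n * x := by positivity
    linarith
  have hint : ∀ n, Integrable (F n) μ := fun n => (hint0 n).ofReal.const_mul _
  have hnorm : ∀ n, ∫ x, ‖F n x‖ ∂μ = |t| ^ n / n.factorial * ∫ x, Real.exp (-(n * x)) ∂μ := by
    intro n
    rw [← integral_const_mul]
    refine integral_congr_ae (ae_of_all _ fun x => ?_)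
    simp only [hF, norm_mul, norm_div, norm_pow, Complex.norm_real, Complex.norm_I, mul_one,
      Real.norm_eq_abs, Real.abs_exp, Complex.norm_natCast]
  have hsum := hasSum_integral_of_summable_integral_norm hint (by
    refine Summable.of_nonneg_of_le (fun n => integral_nonneg fun x => norm_nonneg _) (fun n => ?_)
      ((Real.summable_pow_div_factorial |t|).mul_right (∫ x, Real.exp (-((0 : ℕ) * x)) ∂μ))
    rw [hnorm]
    refine mul_le_mul_of_nonneg_left (integral_mono_ae (hint0 n) (hint0 0) ?_) (by positivity)
    filter_upwards [hμ] with x hx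
    have : 0 ≤ n * x := by positivity
    simpa)
  have e : ∀ x, Complex.exp (t * (Real.exp (-x) : ℝ) * Complex.I) = ∑' n, F n x := by
    intro x
    rw [Complex.exp_eq_exp_ℂ, NormedSpace.exp_eq_tsum_div]
    refine tsum_congr fun n => ?_
    have : Real.exp (-(n * x)) = Real.exp (-x) ^ n := by rw [← Real.exp_nat_mul]; ring_nf
    simp only [hF, this]
    push_cast
    ring
  simp_rw [e]
  rw [← hsum.tsum_eq]
  refine tsum_congr fun n => ?_
  simp only [hF]
  rw [integral_const_mul]
  congr 1
  exact integral_ofReal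

/-- A finite measure on the half-line is determined by its Laplace transform. -/
lemma ext_of_integral_exp_neg {μ₁ μ₂ : Measure ℝ} [IsFiniteMeasure μ₁] [IsFiniteMeasure μ₂]
    (h₁ : ∀ᵐ x ∂μ₁, 0 ≤ x) (h₂ : ∀ᵐ x ∂μ₂, 0 ≤ x)
    (h : ∀ n : ℕ, ∫ x, Real.exp (-(n * x)) ∂μ₁ = ∫ x, Real.exp (-(n * x)) ∂μ₂) : μ₁ = μ₂ := by
  have h3 : (μ₁.map fun x => Real.exp (-x)) = μ₂.map fun x => Real.exp (-x) := by
    apply Measure.ext_of_charFun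
    ext t
    rw [charFun_map_exp_neg μ₁ h₁, charFun_map_exp_neg μ₂ h₂]
    simp_rw [h]
  have h4 := congrArg (Measure.map fun y => -Real.log y) h3
  rw [Measure.map_map (by fun_prop) (by fun_prop), Measure.map_map (by fun_prop) (by fun_prop)]
    at h4
  have e : ((fun y => -Real.log y) ∘ fun x => Real.exp (-x)) = id := by ext x; simp
  simpa [e] using h4

variable {Ω : Type*} [MeasurableSpace Ω] {P : Measure Ω}

/-- Negative moments of a positive random variable in terms of its Laplace transform. -/
lemma lintegral_rpow_neg [SFinite P] {X : Ω → ℝ} (hX : Measurable X) (hpos : ∀ᵐ ω ∂P, 0 < X ω)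
    {a : ℝ} (ha : 0 < a) :
    ENNReal.ofReal (Real.Gamma a) * ∫⁻ ω, ENNReal.ofReal (X ω ^ (-a)) ∂P =
      ∫⁻ γ in Ioi (0 : ℝ), ENNReal.ofReal (γ ^ (a - 1)) *
        ∫⁻ ω, ENNReal.ofReal (Real.exp (-(γ * X ω))) ∂P := by
  -- Pointwise this is the Gamma integral `Γ(a) x^(-a) = ∫ γ^(a-1) exp (-γx) dγ`; Tonelli does the
  -- rest.
  have h1 : ∀ᵐ ω ∂P, ENNReal.ofReal (Real.Gamma a) * ENNReal.ofReal (X ω ^ (-a)) =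
      ∫⁻ γ in Ioi (0 : ℝ), ENNReal.ofReal (γ ^ (a - 1)) *
        ENNReal.ofReal (Real.exp (-(γ * X ω))) := by
    filter_upwards [hpos] with ω hω
    have h := Real.integral_rpow_mul_exp_neg_mul_Ioi ha hω
    have hG := Real.Gamma_pos_of_pos ha
    have hint : IntegrableOn (fun γ : ℝ => γ ^ (a - 1) * Real.exp (-(X ω * γ))) (Ioi 0) := by
      by_contra hc
      rw [integral_undef hc] at h
      have : 0 < (1 / X ω) ^ a * Real.Gamma a := by positivity
      linarith
    rw [← ENNReal.ofReal_mul hG.le, Real.rpow_neg hω.le, ← Real.inv_rpow hω.le, ← one_div,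
      mul_comm, ← h, ofReal_integral_eq_lintegral_ofReal hint]
    · refine setLIntegral_congr_fun measurableSet_Ioi fun γ hγ => ?_
      rw [ENNReal.ofReal_mul (Real.rpow_nonneg hγ.out.le _), mul_comm (X ω)]
    · refine (ae_restrict_iff' measurableSet_Ioi).2 (ae_of_all _ fun γ hγ => ?_)
      have := hγ.out.le
      simp only [Pi.zero_apply]; positivity
  rw [← lintegral_const_mul _ (by fun_prop), lintegral_congr_ae h1, lintegral_lintegral_swap]
  · refine lintegral_congr fun γ => ?_
    rw [lintegral_const_mul _ (by fun_prop)]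
  · exact Measurable.aemeasurable (by fun_prop)

end Laplace

/-! ### Stable subordinators: positivity, scaling, moments of `K₁ ^ (-ν)` -/

namespace IsStableSubordinator

variable {Ω : Type*} [MeasurableSpace Ω] {P : Measure Ω}
  {ν : ℝ} {K : ℝ≥0 → Ω → ℝ≥0}

lemma integral_exp_neg_mul (hK : IsStableSubordinator ν K P) (s : ℝ≥0) {γ : ℝ} (hγ : 0 ≤ γ) :
    ∫ ω, Real.exp (-(γ * (K s ω : ℝ))) ∂P = Real.exp (-((s : ℝ) * γ ^ ν)) := by
  have h := hK.laplace 0 s zero_le γ hγ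
  simp only [NNReal.coe_zero, sub_zero] at h
  rw [← h]
  refine integral_congr_ae ?_
  filter_upwards [hK.zero] with ω hω
  simp [hω]

lemma measurable_real (hK : IsStableSubordinator ν K P) (s : ℝ≥0) :
    Measurable fun ω => (K s ω : ℝ) := (hK.measurable s).coe_nnreal_real

lemma lintegral_exp_neg_mul [IsProbabilityMeasure P]
    (hK : IsStableSubordinator ν K P) (s : ℝ≥0) {γ : ℝ} (hγ : 0 ≤ γ) :
    ∫⁻ ω, ENNReal.ofReal (Real.exp (-(γ * (K s ω : ℝ)))) ∂P =
      ENNReal.ofReal (Real.exp (-((s : ℝ) * γ ^ ν))) := by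
  rw [← hK.integral_exp_neg_mul s hγ, ofReal_integral_eq_lintegral_ofReal]
  · refine Integrable.of_bound
      (by have := hK.measurable s; exact Measurable.aestronglyMeasurable (by fun_prop)) 1
      (ae_of_all _ fun ω => ?_)
    rw [Real.norm_of_nonneg (Real.exp_pos _).le, Real.exp_le_one_iff]
    have : 0 ≤ γ * (K s ω : ℝ) := by positivity
    linarith
  · exact ae_of_all _ fun ω => (Real.exp_pos _).le

/-- The event `K_s = 0` contributes its full probability to `E exp (-n K_s) = exp (-s n^ν)`, which
tends to `0`. -/
lemma ae_pos [IsProbabilityMeasure P]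
    (hK : IsStableSubordinator ν K P) (hν : 0 < ν) {s : ℝ≥0} (hs : 0 < s) :
    ∀ᵐ ω ∂P, 0 < (K s ω : ℝ) := by
  have h1 : ∀ n : ℕ, P {ω | ¬ 0 < (K s ω : ℝ)} ≤
      ENNReal.ofReal (Real.exp (-((s : ℝ) * (n : ℝ) ^ ν))) := by
    intro n
    have hm : MeasurableSet {ω | ¬ 0 < (K s ω : ℝ)} :=
      (measurableSet_lt measurable_const (hK.measurable_real s)).compl
    rw [← hK.lintegral_exp_neg_mul s (Nat.cast_nonneg n), ← lintegral_indicator_one hm]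
    refine lintegral_mono (indicator_le fun ω hω => ?_)
    have : (K s ω : ℝ) = 0 := le_antisymm (not_lt.1 hω) NNReal.zero_le_coe
    simp [this]
  have h2 : Tendsto (fun n : ℕ => ENNReal.ofReal (Real.exp (-((s : ℝ) * (n : ℝ) ^ ν)))) atTop
      (𝓝 0) := by
    rw [← ENNReal.ofReal_zero]
    refine ENNReal.tendsto_ofReal (Real.tendsto_exp_neg_atTop_nhds_zero.comp ?_)
    exact (((tendsto_rpow_atTop hν).comp tendsto_natCast_atTop_atTop).const_mul_atTop
      (by exact_mod_cast hs))
  exact le_antisymm (ge_of_tendsto' h2 h1) zero_le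

/-- Self-similarity of a stable subordinator. -/
lemma map_eq_map_rpow_mul [IsProbabilityMeasure P]
    (hK : IsStableSubordinator ν K P) (hν : 0 < ν) (s : ℝ≥0) :
    P.map (fun ω => (K s ω : ℝ)) = P.map fun ω => (s : ℝ) ^ ν⁻¹ * (K 1 ω : ℝ) := by
  have hm := hK.measurable_real s
  have hm1 := hK.measurable_real 1
  have hm2 : AEMeasurable (fun ω => (s : ℝ) ^ ν⁻¹ * (K 1 ω : ℝ)) P :=
    (hm1.const_mul _).aemeasurable
  have := Measure.isProbabilityMeasure_map (μ := P) hm.aemeasurable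
  have := Measure.isProbabilityMeasure_map (μ := P) hm2
  apply ext_of_integral_exp_neg
  · rw [ae_map_iff hm.aemeasurable measurableSet_Ici]
    exact ae_of_all _ fun ω => NNReal.zero_le_coe
  · rw [ae_map_iff hm2 measurableSet_Ici]
    exact ae_of_all _ fun ω => by positivity
  · intro n
    rw [integral_map hm.aemeasurable (by fun_prop), integral_map hm2 (by fun_prop),
      hK.integral_exp_neg_mul s (Nat.cast_nonneg n)]
    simp_rw [← mul_assoc]
    rw [hK.integral_exp_neg_mul 1 (by positivity),
      Real.mul_rpow (Nat.cast_nonneg n) (by positivity), ← Real.rpow_mul (by positivity),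
      inv_mul_cancel₀ hν.ne', Real.rpow_one]
    simp [mul_comm]

/-- The moments of `K₁ ^ (-ν)`. -/
lemma lintegral_rpow_neg_mul [IsProbabilityMeasure P]
    (hK : IsStableSubordinator ν K P) (hν : 0 < ν) (n : ℕ) :
    ∫⁻ ω, ENNReal.ofReal (((K 1 ω : ℝ) ^ (-ν)) ^ n) ∂P =
      ENNReal.ofReal (n.factorial / Real.Gamma (ν * n + 1)) := by
  rcases Nat.eq_zero_or_pos n with rfl | hn
  · simp
  have hn' : (0 : ℝ) < n := by exact_mod_cast hn
  have ha : 0 < ν * n := by positivity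
  have hG := Real.Gamma_pos_of_pos ha
  have h := lintegral_rpow_neg (P := P) (hK.measurable_real 1) (hK.ae_pos hν one_pos) ha
  -- The inner integral is `exp (-γ^ν)`, so the substitution `γ^ν` yields `Γ(n)/ν`. Dividing by
  -- `Γ(νn)` gives `n!/Γ(νn + 1)`.
  have h2 : ∫⁻ γ in Ioi (0 : ℝ), ENNReal.ofReal (γ ^ (ν * n - 1)) *
        ∫⁻ ω, ENNReal.ofReal (Real.exp (-(γ * (K 1 ω : ℝ)))) ∂P =
      ENNReal.ofReal (1 / ν * Real.Gamma n) := by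
    have h3 := integral_rpow_mul_exp_neg_rpow hν (show -1 < ν * n - 1 by linarith)
    rw [sub_add_cancel, mul_div_cancel_left₀ _ hν.ne'] at h3
    have hGn := Real.Gamma_pos_of_pos hn'
    rw [← h3, ofReal_integral_eq_lintegral_ofReal]
    · refine setLIntegral_congr_fun measurableSet_Ioi fun γ hγ => ?_
      rw [hK.lintegral_exp_neg_mul 1 hγ.out.le, ENNReal.ofReal_mul (Real.rpow_nonneg hγ.out.le _)]
      simp
    · by_contra hc
      rw [integral_undef hc] at h3
      have : 0 < 1 / ν * Real.Gamma n := by positivity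
      linarith
    · refine (ae_restrict_iff' measurableSet_Ioi).2 (ae_of_all _ fun γ hγ => ?_)
      have := hγ.out.le
      simp only [Pi.zero_apply]; positivity
  rw [h2] at h
  have h5 : ∀ ω, ((K 1 ω : ℝ) ^ (-ν)) ^ n = (K 1 ω : ℝ) ^ (-(ν * n)) := fun ω => by
    rw [← Real.rpow_natCast, ← Real.rpow_mul NNReal.zero_le_coe]; ring_nf
  simp_rw [h5]
  have h6 : ENNReal.ofReal (Real.Gamma (ν * n)) ≠ 0 := by simpa using hG
  rw [← ENNReal.mul_right_inj h6 ENNReal.ofReal_ne_top, h, ← ENNReal.ofReal_mul hG.le]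
  congr 1
  obtain ⟨m, rfl⟩ := Nat.exists_eq_succ_of_ne_zero hn.ne'
  rw [Real.Gamma_add_one ha.ne', Nat.succ_eq_add_one, Nat.factorial_succ]
  push_cast
  rw [Real.Gamma_nat_eq_factorial]
  field_simp

lemma integrable_rpow_neg_pow [IsProbabilityMeasure P]
    (hK : IsStableSubordinator ν K P) (hν : 0 < ν) (n : ℕ) :
    Integrable (fun ω => ((K 1 ω : ℝ) ^ (-ν)) ^ n) P := by
  refine ⟨(((hK.measurable_real 1).pow_const _).pow_const _).aestronglyMeasurable, ?_⟩
  rw [hasFiniteIntegral_iff_ofReal (ae_of_all _ fun ω => by positivity),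
    hK.lintegral_rpow_neg_mul hν n]
  exact ENNReal.ofReal_lt_top

lemma integral_rpow_neg_pow [IsProbabilityMeasure P]
    (hK : IsStableSubordinator ν K P) (hν : 0 < ν) (n : ℕ) :
    ∫ ω, ((K 1 ω : ℝ) ^ (-ν)) ^ n ∂P = n.factorial / Real.Gamma (ν * n + 1) := by
  rw [integral_eq_lintegral_of_nonneg_ae
    (ae_of_all _ fun ω => by simp only [Pi.zero_apply]; positivity)
    (hK.integrable_rpow_neg_pow hν n).1, hK.lintegral_rpow_neg_mul hν n, ENNReal.toReal_ofReal]
  have := Gamma_mul_add_one_pos hν n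
  positivity

/-- The Mittag-Leffler function is the Laplace transform of `K₁ ^ (-ν)`. -/
lemma integral_exp_neg_mul_rpow_neg [IsProbabilityMeasure P]
    (hK : IsStableSubordinator ν K P) (hν : 0 < ν) (x : ℝ) :
    ∫ ω, Real.exp (-(x * (K 1 ω : ℝ) ^ (-ν))) ∂P = mittagLeffler ν (-x) := by
  set F : ℕ → Ω → ℝ := fun n ω => (-x) ^ n / n.factorial * ((K 1 ω : ℝ) ^ (-ν)) ^ n with hF
  have hint : ∀ n, Integrable (F n) P := fun n => (hK.integrable_rpow_neg_pow hν n).const_mul _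
  have hnorm : ∀ n, ∫ ω, ‖F n ω‖ ∂P = |x| ^ n / Real.Gamma (ν * n + 1) := by
    intro n
    have : ∀ ω, ‖F n ω‖ = |x| ^ n / n.factorial * ((K 1 ω : ℝ) ^ (-ν)) ^ n := fun ω => by
      have h0 : 0 ≤ ((K 1 ω : ℝ) ^ (-ν)) ^ n := by positivity
      simp only [hF, norm_mul, norm_div, norm_pow, norm_neg, Real.norm_eq_abs, Nat.abs_cast]
      rw [abs_of_nonneg (a := (K 1 ω : ℝ) ^ (-ν)) (by positivity)]
    simp_rw [this]
    rw [integral_const_mul, hK.integral_rpow_neg_pow hν]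
    have := n.factorial_ne_zero
    field_simp
  have hsum := hasSum_integral_of_summable_integral_norm hint
    (by simp_rw [hnorm]; exact summable_abs_mittagLeffler hν x)
  have e : ∀ ω, Real.exp (-(x * (K 1 ω : ℝ) ^ (-ν))) = ∑' n, F n ω := fun ω => by
    rw [Real.exp_eq_exp_ℝ, NormedSpace.exp_eq_tsum_div]
    refine tsum_congr fun n => ?_
    simp only [hF]
    rw [← neg_mul, mul_pow]
    ring
  simp_rw [e]
  rw [← hsum.tsum_eq, mittagLeffler]
  refine tsum_congr fun n => ?_
  simp only [hF]
  rw [integral_const_mul, hK.integral_rpow_neg_pow hν]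
  have := n.factorial_ne_zero
  field_simp

end IsStableSubordinator

/-! ### Evaluation of right-continuous paths at independent random times -/

section PathEvaluation

/-- A sequence of discretizations which approximates `s` from the right. -/
noncomputable def rightApprox (n : ℕ) (s : ℝ≥0) : ℝ≥0 := (⌊(n + 1) * s⌋₊ + 1) / (n + 1)

lemma lt_rightApprox (n : ℕ) (s : ℝ≥0) : s < rightApprox n s := by
  rw [rightApprox, lt_div_iff₀ (by positivity), mul_comm]
  exact Nat.lt_floor_add_one _

lemma rightApprox_le (n : ℕ) (s : ℝ≥0) : rightApprox n s ≤ s + 1 / (n + 1) := by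
  rw [rightApprox, add_div]
  gcongr
  rw [div_le_iff₀ (by positivity), mul_comm]
  exact Nat.floor_le zero_le

lemma tendsto_rightApprox (s : ℝ≥0) : Tendsto (fun n => rightApprox n s) atTop (𝓝[≥] s) := by
  refine tendsto_nhdsWithin_iff.2 ⟨?_, Eventually.of_forall fun n => (lt_rightApprox n s).le⟩
  refine tendsto_of_tendsto_of_tendsto_of_le_of_le tendsto_const_nhds ?_
    (fun n => (lt_rightApprox n s).le) (fun n => rightApprox_le n s)
  have h : Tendsto (fun n : ℕ => s + 1 / ((n : ℝ≥0) + 1)) atTop (𝓝 (s + 0)) := by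
    refine tendsto_const_nhds.add ?_
    exact tendsto_one_div_add_atTop_nhds_zero_nat
  simpa using h

/-- A jointly measurable version of the evaluation `(h, s) ↦ h s` of right-continuous paths. -/
noncomputable def evalRight (h : ℝ≥0 → ℝ) (s : ℝ≥0) : ℝ :=
  limsup (fun n : ℕ => h (rightApprox n s)) atTop

lemma evalRight_eq {h : ℝ≥0 → ℝ} {s : ℝ≥0} (hs : ContinuousWithinAt h (Ici s) s) :
    evalRight h s = h s :=
  (hs.tendsto.comp (tendsto_rightApprox s)).limsup_eq

/-- The point `rightApprox n s` depends on `s` only through an integer, so each approximation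
involves countably many coordinates of the path. Taking a `limsup` keeps measurability on all paths,
regular or not. -/
lemma measurable_evalRight : Measurable fun p : (ℝ≥0 → ℝ) × ℝ≥0 => evalRight p.1 p.2 := by
  refine Measurable.limsup fun n => ?_
  have h1 : Measurable fun q : (ℝ≥0 → ℝ) × ℕ => q.1 (((q.2 : ℝ≥0) + 1) / (n + 1)) :=
    measurable_from_prod_countable_left fun m =>
      measurable_pi_apply (((m : ℝ≥0) + 1) / (n + 1))
  have h2 : Measurable fun p : (ℝ≥0 → ℝ) × ℝ≥0 => (p.1, ⌊((n : ℝ≥0) + 1) * p.2⌋₊) :=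
    measurable_fst.prodMk (Nat.measurable_floor.comp (measurable_snd.const_mul _))
  exact h1.comp h2

variable {Ω : Type*} [MeasurableSpace Ω] {P : Measure Ω}
  {X : ℝ≥0 → Ω → ℝ} {τ : Ω → ℝ≥0}

lemma ae_evalRight_eq (hr : ∀ᵐ ω ∂P, ∀ t, ContinuousWithinAt (fun s => X s ω) (Ici t) t) :
    ∀ᵐ ω ∂P, ∀ t, evalRight (fun s => X s ω) t = X t ω := by
  filter_upwards [hr] with ω hω t using evalRight_eq (hω t)

lemma aemeasurable_randomTime (hX : ∀ t, Measurable (X t)) (hτ : Measurable τ)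
    (hr : ∀ᵐ ω ∂P, ∀ t, ContinuousWithinAt (fun s => X s ω) (Ici t) t) :
    AEMeasurable (fun ω => X (τ ω) ω) P := by
  have h1 : Measurable fun ω => ((fun s => X s ω), τ ω) := (measurable_pi_lambda _ hX).prodMk hτ
  refine ⟨_, measurable_evalRight.comp h1, ?_⟩
  filter_upwards [ae_evalRight_eq hr] with ω hω using (hω _).symm

/-- Fubini for independent random variables. -/
lemma lintegral_comp_of_indepFun [IsProbabilityMeasure P] {E F : Type*} [MeasurableSpace E]
    [MeasurableSpace F] {U : Ω → E} {V : Ω → F} (hU : Measurable U) (hV : Measurable V)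
    (hind : IndepFun U V P) {g : E × F → ℝ≥0∞} (hg : Measurable g) :
    ∫⁻ ω, g (U ω, V ω) ∂P = ∫⁻ ω', ∫⁻ ω, g (U ω, V ω') ∂P ∂P := by
  have := Measure.isProbabilityMeasure_map (μ := P) hU.aemeasurable
  have := Measure.isProbabilityMeasure_map (μ := P) hV.aemeasurable
  rw [← lintegral_map hg (hU.prodMk hV),
    (indepFun_iff_map_prod_eq_prod_map_map hU.aemeasurable hV.aemeasurable).1 hind,
    lintegral_prod_symm _ hg.aemeasurable, lintegral_map hg.lintegral_prod_left' hV]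
  refine lintegral_congr fun ω' => ?_
  have hm : Measurable fun e => g (e, V ω') := hg.comp measurable_prodMk_right
  rw [lintegral_map hm hU]

/-- Conditioning on an independent random time. -/
lemma lintegral_randomTime [IsProbabilityMeasure P] (hX : ∀ t, Measurable (X t))
    (hτ : Measurable τ) (hr : ∀ᵐ ω ∂P, ∀ t, ContinuousWithinAt (fun s => X s ω) (Ici t) t)
    (hind : IndepFun (fun ω t => X t ω) τ P) {f : ℝ → ℝ≥0∞} (hf : Measurable f) :
    ∫⁻ ω, f (X (τ ω) ω) ∂P = ∫⁻ ω', ∫⁻ ω, f (X (τ ω') ω) ∂P ∂P := by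
  have hev := ae_evalRight_eq hr
  have h := lintegral_comp_of_indepFun (measurable_pi_lambda _ hX) hτ hind
    (hf.comp measurable_evalRight)
  simp only [Function.comp_apply] at h
  have h1 : ∫⁻ ω, f (X (τ ω) ω) ∂P = ∫⁻ ω, f (evalRight (fun s => X s ω) (τ ω)) ∂P :=
    lintegral_congr_ae (hev.mono fun ω hω => by simp only [hω])
  rw [h1, h]
  exact lintegral_congr fun ω' => lintegral_congr_ae (hev.mono fun ω hω => by simp only [hω])

end PathEvaluation

/-! ### The inverse subordinator and its law -/

/-- The inverse of a nondecreasing right-continuous path, computed along rational times. -/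
noncomputable def pathInverse (t : ℝ) (k : ℝ≥0 → ℝ) : ℝ≥0 :=
  (⨅ q : ℚ, if t ≤ k (Real.toNNReal q) then ((Real.toNNReal q : ℝ≥0) : ℝ≥0∞) else ⊤).toNNReal

lemma measurable_pathInverse (t : ℝ) : Measurable (pathInverse t) := by
  refine ENNReal.measurable_toNNReal.comp (Measurable.iInf fun q => ?_)
  exact Measurable.ite (measurableSet_le measurable_const (measurable_pi_apply _))
    measurable_const measurable_const

namespace IsStableSubordinator

variable {Ω : Type*} [MeasurableSpace Ω] {P : Measure Ω}
  {ν : ℝ} {K : ℝ≥0 → Ω → ℝ≥0}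

/-- Markov's inequality: `P(K_n < t) ≤ e^t E exp (-K_n) = e^t e^(-n)`. -/
lemma ae_exists_ge [IsProbabilityMeasure P] (hK : IsStableSubordinator ν K P) (t : ℝ≥0) :
    ∀ᵐ ω ∂P, ∃ s, t ≤ K s ω := by
  have h1 : ∀ n : ℕ, P {ω | ¬ ∃ s, t ≤ K s ω} ≤
      ENNReal.ofReal (Real.exp t) * ENNReal.ofReal (Real.exp (-(n : ℝ))) := by
    intro n
    have h2 := hK.lintegral_exp_neg_mul n zero_le_one
    simp only [one_mul, NNReal.coe_natCast, Real.one_rpow, mul_one] at h2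
    rw [← h2, ← lintegral_const_mul _ (by have := hK.measurable n; fun_prop)]
    have hm : MeasurableSet {ω | K n ω < t} := measurableSet_lt (hK.measurable _) measurable_const
    calc P {ω | ¬ ∃ s, t ≤ K s ω} ≤ P {ω | K n ω < t} :=
          measure_mono fun ω hω => not_le.1 fun h => hω ⟨_, h⟩
      _ = ∫⁻ ω, {ω | K n ω < t}.indicator 1 ω ∂P := (lintegral_indicator_one hm).symm
      _ ≤ _ := by
        refine lintegral_mono (indicator_le fun ω hω => ?_)
        have h3 : (K n ω : ℝ) ≤ t := by exact_mod_cast (le_of_lt hω)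
        rw [← ENNReal.ofReal_mul (Real.exp_pos _).le, ← Real.exp_add, Pi.one_apply,
          ENNReal.one_le_ofReal]
        exact Real.one_le_exp (by linarith)
  have h2 : Tendsto (fun n : ℕ => ENNReal.ofReal (Real.exp t) *
      ENNReal.ofReal (Real.exp (-(n : ℝ)))) atTop (𝓝 0) := by
    have h3 : Tendsto (fun n : ℕ => ENNReal.ofReal (Real.exp (-(n : ℝ)))) atTop (𝓝 0) := by
      rw [← ENNReal.ofReal_zero]
      exact ENNReal.tendsto_ofReal
        (Real.tendsto_exp_neg_atTop_nhds_zero.comp tendsto_natCast_atTop_atTop)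
    simpa using ENNReal.Tendsto.const_mul h3 (Or.inr ENNReal.ofReal_ne_top)
  exact le_antisymm (ge_of_tendsto' h2 h1) zero_le

/-- Almost surely, `L t ≤ s` if and only if `t ≤ K s`. -/
lemma ae_inverse_le_iff [IsProbabilityMeasure P]
    (hK : IsStableSubordinator ν K P) {t : ℝ≥0} (ht : 0 < t) :
    ∀ᵐ ω ∂P, ∀ s, inverseSubordinator K t ω ≤ s ↔ t ≤ K s ω := by
  filter_upwards [hK.zero, hK.mono, hK.rightCont, hK.ae_exists_ge t] with ω h0 hm hr hex s
  have hpos : ∀ s, t ≤ K s ω → 0 < s := fun s hs => by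
    rw [pos_iff_ne_zero]
    rintro rfl
    rw [h0] at hs
    exact absurd ht (not_lt.2 hs)
  have hbdd : BddBelow {s : ℝ≥0 | 0 < s ∧ t ≤ K s ω} := OrderBot.bddBelow _
  have hne : {s : ℝ≥0 | 0 < s ∧ t ≤ K s ω}.Nonempty := by
    obtain ⟨s, hs⟩ := hex
    exact ⟨s, hpos s hs, hs⟩
  refine ⟨fun h => ?_, fun h => csInf_le hbdd ⟨hpos s h, h⟩⟩
  -- Every `s' > s` lies above a point of the level set, so monotonicity gives `t ≤ K s'`;
  -- right-continuity then brings this down to `s`.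
  have hgt : ∀ s' ∈ Ioi s, t ≤ K s' ω := fun s' hs' => by
    obtain ⟨r, hr, hrs⟩ := exists_lt_of_csInf_lt hne (lt_of_le_of_lt h hs')
    exact hr.2.trans (hm hrs.le)
  have hcont : Tendsto (fun s => K s ω) (𝓝[>] s) (𝓝 (K s ω)) := (hr s).mono Ioi_subset_Ici_self
  exact ge_of_tendsto hcont (eventually_nhdsWithin_of_forall hgt)

/-- Almost surely the times with `t ≤ K s` form the closed half-line starting at `L t`, whose
infimum is already reached along rationals. -/
lemma ae_pathInverse_eq [IsProbabilityMeasure P]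
    (hK : IsStableSubordinator ν K P) {t : ℝ≥0} (ht : 0 < t) :
    ∀ᵐ ω ∂P, pathInverse t (fun s => (K s ω : ℝ)) = inverseSubordinator K t ω := by
  filter_upwards [hK.ae_inverse_le_iff ht] with ω h
  have : (⨅ q : ℚ, if (t : ℝ) ≤ (K (Real.toNNReal q) ω : ℝ) then
      ((Real.toNNReal q : ℝ≥0) : ℝ≥0∞) else ⊤) = (inverseSubordinator K t ω : ℝ≥0∞) := by
    refine le_antisymm (le_of_forall_gt fun c hc => ?_) (le_iInf fun q => ?_)
    · obtain ⟨q, -, hq, hqc⟩ := ENNReal.lt_iff_exists_rat_btwn.1 hc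
      refine (iInf_le _ q).trans_lt ?_
      rw [if_pos]
      · exact hqc
      · exact_mod_cast (h _).1 (by exact_mod_cast hq.le)
    · split_ifs with hq
      · exact_mod_cast (h _).2 (by exact_mod_cast hq)
      · exact le_top
  rw [pathInverse, this, ENNReal.toNNReal_coe]

lemma measurable_pathInverse_comp (hK : IsStableSubordinator ν K P) (t : ℝ≥0) :
    Measurable fun ω => pathInverse t (fun s => (K s ω : ℝ)) :=
  (measurable_pathInverse t).comp (measurable_pi_lambda _ hK.measurable_real)

/-- The inverse `L t` has the law of `t ^ ν * K₁ ^ (-ν)`. -/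
lemma map_pathInverse [IsProbabilityMeasure P]
    (hK : IsStableSubordinator ν K P) (hν : 0 < ν) {t : ℝ≥0} (ht : 0 < t) :
    P.map (fun ω => (pathInverse t (fun s => (K s ω : ℝ)) : ℝ)) =
      P.map fun ω => (t : ℝ) ^ ν * (K 1 ω : ℝ) ^ (-ν) := by
  have hm1 := (hK.measurable_pathInverse_comp t).coe_nnreal_real
  have hm2 : Measurable fun ω => (t : ℝ) ^ ν * (K 1 ω : ℝ) ^ (-ν) :=
    ((hK.measurable_real 1).pow_const _).const_mul _
  have := Measure.isProbabilityMeasure_map (μ := P) hm1.aemeasurable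
  refine Measure.ext_of_Iic _ _ fun s => ?_
  rw [Measure.map_apply hm1 measurableSet_Iic, Measure.map_apply hm2 measurableSet_Iic]
  have htpos : (0 : ℝ) < t := by exact_mod_cast ht
  rcases lt_or_ge s 0 with hs | hs
  · have e1 : (fun ω => (pathInverse t (fun s => (K s ω : ℝ)) : ℝ)) ⁻¹' Iic s = ∅ := by
      ext ω
      simp only [mem_preimage, mem_Iic, mem_empty_iff_false, iff_false, not_le]
      exact hs.trans_le NNReal.zero_le_coe
    have e2 : (fun ω => (t : ℝ) ^ ν * (K 1 ω : ℝ) ^ (-ν)) ⁻¹' Iic s = ∅ := by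
      ext ω
      simp only [mem_preimage, mem_Iic, mem_empty_iff_false, iff_false, not_le]
      exact hs.trans_le (by positivity)
    rw [e1, e2]
  lift s to ℝ≥0 using hs
  -- Inversion turns `L t ≤ s` into `t ≤ K_s`; self-similarity replaces `K_s` by `s^(1/ν) K₁`;
  -- solving for `s` gives `t^ν K₁^(-ν) ≤ s`.
  calc P ((fun ω => (pathInverse t (fun s => (K s ω : ℝ)) : ℝ)) ⁻¹' Iic (s : ℝ))
      = P ((fun ω => (K s ω : ℝ)) ⁻¹' Ici (t : ℝ)) := by
        refine measure_congr ?_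
        filter_upwards [hK.ae_pathInverse_eq ht, hK.ae_inverse_le_iff ht] with ω h1 h2
        refine propext ?_
        change (pathInverse t (fun s => (K s ω : ℝ)) : ℝ) ≤ s ↔ (t : ℝ) ≤ K s ω
        rw [h1, NNReal.coe_le_coe, h2, NNReal.coe_le_coe]
    _ = P ((fun ω => (s : ℝ) ^ ν⁻¹ * (K 1 ω : ℝ)) ⁻¹' Ici (t : ℝ)) := by
        rw [← Measure.map_apply (hK.measurable_real s) measurableSet_Ici,
          hK.map_eq_map_rpow_mul hν s,
          Measure.map_apply ((hK.measurable_real 1).const_mul _) measurableSet_Ici]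
    _ = _ := by
        refine measure_congr ?_
        filter_upwards [hK.ae_pos hν one_pos] with ω h
        refine propext ?_
        change (t : ℝ) ≤ (s : ℝ) ^ ν⁻¹ * (K 1 ω : ℝ) ↔ (t : ℝ) ^ ν * (K 1 ω : ℝ) ^ (-ν) ≤ s
        rw [Real.rpow_neg h.le, ← div_eq_mul_inv, div_le_iff₀ (by positivity),
          ← Real.rpow_le_rpow_iff (z := ν) htpos.le (by positivity) hν,
          Real.mul_rpow (by positivity) h.le, ← Real.rpow_mul NNReal.zero_le_coe,
          inv_mul_cancel₀ hν.ne', Real.rpow_one]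

/-- The Laplace transform of the inverse of a stable subordinator. -/
lemma integral_exp_neg_mul_pathInverse [IsProbabilityMeasure P]
    (hK : IsStableSubordinator ν K P) (hν : 0 < ν) {t : ℝ≥0}
    (ht : 0 < t) (l : ℝ) :
    ∫ ω, Real.exp (-(l * (pathInverse t (fun s => (K s ω : ℝ)) : ℝ))) ∂P =
      mittagLeffler ν (-(l * (t : ℝ) ^ ν)) := by
  have hm1 := (hK.measurable_pathInverse_comp t).coe_nnreal_real
  have hm2 : Measurable fun ω => (t : ℝ) ^ ν * (K 1 ω : ℝ) ^ (-ν) :=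
    ((hK.measurable_real 1).pow_const _).const_mul _
  have h := integral_map (μ := P) (f := fun x => Real.exp (-(l * x))) hm1.aemeasurable
    (by fun_prop)
  rw [← h, hK.map_pathInverse hν ht, integral_map hm2.aemeasurable (by fun_prop),
    ← hK.integral_exp_neg_mul_rpow_neg hν]
  simp_rw [mul_assoc]

end IsStableSubordinator

/-! ### Decay and regularity of `x ↦ E_ν(-x)` -/

lemma measurable_exp_neg_const_mul {α : Type*} [MeasurableSpace α] {f : α → ℝ} (hf : Measurable f)
    (l : ℝ) : Measurable fun a => Real.exp (-(l * f a)) := by fun_prop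

/-- Layer-cake form of `exp (-l x)`: after averaging over `x = L t`, only `P(L t < s)` has to be
estimated. -/
lemma lintegral_indicator_exp_neg {l x : ℝ} (hl : 0 < l) (hx : 0 ≤ x) :
    ∫⁻ s in Ioi (0 : ℝ), (Ioi x).indicator (fun s => ENNReal.ofReal (l * Real.exp (-(l * s)))) s =
      ENNReal.ofReal (Real.exp (-(l * x))) := by
  rw [lintegral_indicator measurableSet_Ioi, Measure.restrict_restrict measurableSet_Ioi,
    inter_eq_left.2 (Ioi_subset_Ioi hx)]
  have hint := (integrableOn_exp_mul_Ioi (neg_lt_zero.2 hl) x).const_mul l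
  have h := integral_exp_mul_Ioi (neg_lt_zero.2 hl) x
  simp only [neg_mul] at hint h
  rw [← ofReal_integral_eq_lintegral_ofReal hint
    (ae_of_all _ fun s => by simp only [Pi.zero_apply]; positivity), integral_const_mul, h]
  congr 1
  field_simp

lemma lintegral_mul_exp_neg_mul {l : ℝ} (hl : 0 < l) :
    ∫⁻ s in Ioi (0 : ℝ), ENNReal.ofReal (l * Real.exp (-(l * s))) * ENNReal.ofReal s =
      ENNReal.ofReal (1 / l) := by
  have h := Real.integral_rpow_mul_exp_neg_mul_Ioi (a := 2) two_pos hl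
  have hint : IntegrableOn (fun γ : ℝ => γ ^ ((2 : ℝ) - 1) * Real.exp (-(l * γ))) (Ioi 0) := by
    by_contra hc
    rw [integral_undef hc] at h
    have : 0 < (1 / l) ^ (2 : ℝ) * Real.Gamma 2 := by
      have := Real.Gamma_pos_of_pos (two_pos (α := ℝ)); positivity
    linarith
  rw [Real.Gamma_two, mul_one, Real.rpow_two] at h
  have e : (1 / l) = l * ∫ (t : ℝ) in Ioi 0, t ^ ((2 : ℝ) - 1) * Real.exp (-(l * t)) := by
    rw [h]; field_simp
  rw [e, ← integral_const_mul, ofReal_integral_eq_lintegral_ofReal (hint.const_mul l)]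
  · refine setLIntegral_congr_fun measurableSet_Ioi fun s hs => ?_
    have h2 : (2 : ℝ) - 1 = 1 := by norm_num
    rw [← ENNReal.ofReal_mul (by positivity), h2, Real.rpow_one]
    ring_nf
  · refine (ae_restrict_iff' measurableSet_Ioi).2 (ae_of_all _ fun γ hγ => ?_)
    have := hγ.out.le
    simp only [Pi.zero_apply]; positivity

namespace IsStableSubordinator

variable {Ω : Type*} [MeasurableSpace Ω] {P : Measure Ω}
  {ν : ℝ} {K : ℝ≥0 → Ω → ℝ≥0}

/-- Markov's inequality for `1 - exp (-K_s)`, whose mean `1 - exp (-s)` is at most `s`. As `{L t <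
s}` is almost surely contained in `{t ≤ K_s}`, the law of `L t` puts mass `O(s)` near `0`. -/
lemma measure_ge_le [IsProbabilityMeasure P] (hK : IsStableSubordinator ν K P) (s t : ℝ≥0) :
    ENNReal.ofReal (1 - Real.exp (-t)) * P {ω | t ≤ K s ω} ≤ ENNReal.ofReal s := by
  have hm : MeasurableSet {ω | t ≤ K s ω} := measurableSet_le measurable_const (hK.measurable s)
  have hint : Integrable (fun ω => Real.exp (-(K s ω : ℝ))) P := by
    refine Integrable.of_bound
      (by have := hK.measurable s; exact Measurable.aestronglyMeasurable (by fun_prop)) 1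
      (ae_of_all _ fun ω => ?_)
    rw [Real.norm_of_nonneg (Real.exp_pos _).le, Real.exp_le_one_iff]
    simp
  have h := hK.integral_exp_neg_mul s zero_le_one
  simp only [one_mul, Real.one_rpow, mul_one] at h
  rw [← lintegral_indicator_const hm]
  calc ∫⁻ ω, {ω | t ≤ K s ω}.indicator (fun _ => ENNReal.ofReal (1 - Real.exp (-t))) ω ∂P
      ≤ ∫⁻ ω, ENNReal.ofReal (1 - Real.exp (-(K s ω : ℝ))) ∂P := by
        refine lintegral_mono (indicator_le fun ω hω => ?_)
        have : (t : ℝ) ≤ K s ω := by exact_mod_cast hω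
        gcongr
    _ = ENNReal.ofReal (1 - Real.exp (-(s : ℝ))) := by
        have h1 : Integrable (fun ω => 1 - Real.exp (-(K s ω : ℝ))) P :=
          (integrable_const _).sub hint
        rw [← ofReal_integral_eq_lintegral_ofReal h1 (ae_of_all _ fun ω => by simp),
          integral_sub (integrable_const _) hint, h]
        simp
    _ ≤ ENNReal.ofReal s := by
        have := Real.add_one_le_exp (-(s : ℝ))
        exact ENNReal.ofReal_le_ofReal (by linarith)

/-- The Mittag-Leffler function decays at least like `1 / x` at `-∞`. -/
lemma mittagLeffler_neg_le [IsProbabilityMeasure P] (hK : IsStableSubordinator ν K P)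
    (hν : 0 < ν) {t : ℝ≥0} (ht : 0 < t) {l : ℝ} (hl : 0 < l) :
    mittagLeffler ν (-(l * (t : ℝ) ^ ν)) ≤ (1 - Real.exp (-t))⁻¹ / l := by
  have hc : 0 < 1 - Real.exp (-(t : ℝ)) := by
    have : Real.exp (-(t : ℝ)) < 1 := by simpa using ht
    linarith
  set c := 1 - Real.exp (-(t : ℝ))
  set L : Ω → ℝ := fun ω => pathInverse t (fun s => (K s ω : ℝ)) with hL
  have hLm : Measurable L := (hK.measurable_pathInverse_comp t).coe_nnreal_real
  have hL0 : ∀ ω, 0 ≤ L ω := fun ω => NNReal.zero_le_coe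
  have hP : ∀ s ∈ Ioi (0 : ℝ), P {ω | L ω < s} ≤ ENNReal.ofReal c⁻¹ * ENNReal.ofReal s := by
    intro s hs
    lift s to ℝ≥0 using hs.out.le
    have h1 : P {ω | L ω < s} ≤ P {ω | t ≤ K s ω} := by
      refine measure_mono_ae ?_
      filter_upwards [hK.ae_pathInverse_eq ht, hK.ae_inverse_le_iff ht] with ω h1 h2 h3
      refine (h2 s).1 ?_
      rw [← h1]
      exact_mod_cast (le_of_lt h3 : L ω ≤ s)
    refine h1.trans ?_
    rw [ENNReal.ofReal_inv_of_pos hc, ← ENNReal.div_eq_inv_mul,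
      ENNReal.le_div_iff_mul_le (by simp [hc]) (by simp), mul_comm]
    exact hK.measure_ge_le s t
  -- `E exp (-l L) = ∫ l exp (-l s) P(L < s) ds`, and inserting `P(L < s) ≤ s / c` leaves `1 / (c
  -- l)`.
  have hmain : ∫⁻ ω, ENNReal.ofReal (Real.exp (-(l * L ω))) ∂P ≤ ENNReal.ofReal (c⁻¹ / l) := by
    calc ∫⁻ ω, ENNReal.ofReal (Real.exp (-(l * L ω))) ∂P
        = ∫⁻ ω, (∫⁻ s in Ioi (0 : ℝ),
            (Ioi (L ω)).indicator (fun s => ENNReal.ofReal (l * Real.exp (-(l * s)))) s) ∂P :=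
          lintegral_congr fun ω => (lintegral_indicator_exp_neg hl (hL0 ω)).symm
      _ = ∫⁻ ω, (∫⁻ s in Ioi (0 : ℝ), ENNReal.ofReal (l * Real.exp (-(l * s))) *
            {p : Ω × ℝ | L p.1 < p.2}.indicator 1 (ω, s)) ∂P := by
          refine lintegral_congr fun ω => lintegral_congr fun s => ?_
          by_cases h : L ω < s <;> simp [h]
      _ = ∫⁻ s in Ioi (0 : ℝ), ∫⁻ ω, ENNReal.ofReal (l * Real.exp (-(l * s))) *
            {p : Ω × ℝ | L p.1 < p.2}.indicator 1 (ω, s) ∂P := by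
          refine lintegral_lintegral_swap (Measurable.aemeasurable ?_)
          refine Measurable.mul (by fun_prop) (measurable_one.indicator ?_)
          exact measurableSet_lt (hLm.comp measurable_fst) measurable_snd
      _ = ∫⁻ s in Ioi (0 : ℝ), ENNReal.ofReal (l * Real.exp (-(l * s))) * P {ω | L ω < s} := by
          refine lintegral_congr fun s => ?_
          have hm : MeasurableSet {ω | L ω < s} := measurableSet_lt hLm measurable_const
          rw [← lintegral_indicator_one hm, ← lintegral_const_mul _ (measurable_one.indicator hm)]
          rfl
      _ ≤ ∫⁻ s in Ioi (0 : ℝ), ENNReal.ofReal (l * Real.exp (-(l * s))) *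
            (ENNReal.ofReal c⁻¹ * ENNReal.ofReal s) := by
          refine setLIntegral_mono' measurableSet_Ioi fun s hs => ?_
          gcongr
          exact hP s hs
      _ = ENNReal.ofReal (c⁻¹ / l) := by
          simp_rw [mul_left_comm _ (ENNReal.ofReal c⁻¹)]
          rw [lintegral_const_mul _ (by fun_prop), lintegral_mul_exp_neg_mul hl,
            ← ENNReal.ofReal_mul (by positivity), div_eq_mul_one_div c⁻¹ l]
  rw [← hK.integral_exp_neg_mul_pathInverse hν ht]
  change ∫ ω, Real.exp (-(l * L ω)) ∂P ≤ _
  rw [integral_eq_lintegral_of_nonneg_ae (ae_of_all _ fun ω => (Real.exp_pos _).le)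
      (measurable_exp_neg_const_mul hLm l).aestronglyMeasurable]
  exact ENNReal.toReal_le_of_le_ofReal (by positivity) hmain

end IsStableSubordinator

/-- Elementary properties of the Mittag-Leffler function on the negative half-line,
`x ↦ E_ν(-x)`, which hold as it is a Laplace transform. -/
structure MittagLefflerBounds (ν : ℝ) : Prop where
  nonneg : ∀ x, 0 ≤ mittagLeffler ν (-x)
  le_one : ∀ x, 0 ≤ x → mittagLeffler ν (-x) ≤ 1
  abs_sub_le : ∀ x y, 0 ≤ x → 0 ≤ y → |mittagLeffler ν (-x) - mittagLeffler ν (-y)| ≤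
    1 / Real.Gamma (ν + 1) * |x - y|
  tendsto : Tendsto (fun x => mittagLeffler ν (-x)) atTop (𝓝 0)

lemma abs_exp_neg_sub_exp_neg_le {x y : ℝ} (hx : 0 ≤ x) (hy : 0 ≤ y) :
    |Real.exp (-x) - Real.exp (-y)| ≤ |x - y| := by
  wlog h : x ≤ y generalizing x y
  · rw [abs_sub_comm, abs_sub_comm x]
    exact this hy hx (le_of_not_ge h)
  rw [abs_of_nonneg (by simpa using h), abs_of_nonpos (by linarith)]
  have h1 : Real.exp (-y) = Real.exp (-x) * Real.exp (-(y - x)) := by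
    rw [← Real.exp_add]; ring_nf
  have h2 := Real.add_one_le_exp (-(y - x))
  have h3 : Real.exp (-x) ≤ 1 := by simpa using hx
  rw [h1]
  nlinarith [Real.exp_pos (-x)]

/-- All bounds are read off from `E_ν(-x) = E exp (-xY)` with `Y = K₁^(-ν)`: the Lipschitz constant
is the mean `E Y = 1/Γ(ν + 1)`, and the limit at infinity is `0` because `Y > 0` almost surely. -/
lemma IsStableSubordinator.mittagLefflerBounds {Ω : Type*} [MeasurableSpace Ω] {P : Measure Ω}
    [IsProbabilityMeasure P] {ν : ℝ} {K : ℝ≥0 → Ω → ℝ≥0} (hK : IsStableSubordinator ν K P)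
    (hν : 0 < ν) : MittagLefflerBounds ν := by
  set Y : Ω → ℝ := fun ω => (K 1 ω : ℝ) ^ (-ν)
  have hYm : Measurable Y := (hK.measurable_real 1).pow_const _
  have hY0 : ∀ ω, 0 ≤ Y ω := fun ω => by positivity
  have hE : ∀ x, ∫ ω, Real.exp (-(x * Y ω)) ∂P = mittagLeffler ν (-x) :=
    hK.integral_exp_neg_mul_rpow_neg hν
  have hle : ∀ x, 0 ≤ x → ∀ ω, ‖Real.exp (-(x * Y ω))‖ ≤ 1 := fun x hx ω => by
    rw [Real.norm_of_nonneg (Real.exp_pos _).le, Real.exp_le_one_iff]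
    have := mul_nonneg hx (hY0 ω)
    linarith
  have hm : ∀ x, AEStronglyMeasurable (fun ω => Real.exp (-(x * Y ω))) P := fun x =>
    Measurable.aestronglyMeasurable (by fun_prop)
  have hint : ∀ x, 0 ≤ x → Integrable (fun ω => Real.exp (-(x * Y ω))) P := fun x hx =>
    Integrable.of_bound (hm x) 1 (ae_of_all _ (hle x hx))
  have hYint : Integrable Y P := by simpa using hK.integrable_rpow_neg_pow hν 1
  have hYE : ∫ ω, Y ω ∂P = 1 / Real.Gamma (ν + 1) := by
    simpa using hK.integral_rpow_neg_pow hν 1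
  refine ⟨fun x => ?_, fun x hx => ?_, fun x y hx hy => ?_, ?_⟩
  · rw [← hE]
    exact integral_nonneg fun ω => (Real.exp_pos _).le
  · rw [← hE]
    calc ∫ ω, Real.exp (-(x * Y ω)) ∂P ≤ ∫ _, (1 : ℝ) ∂P :=
          integral_mono (hint x hx) (integrable_const _) fun ω =>
            (le_abs_self _).trans (hle x hx ω)
      _ = 1 := by simp
  · rw [← hE, ← hE, ← integral_sub (hint x hx) (hint y hy), ← hYE, mul_comm, ← integral_const_mul]
    refine (norm_integral_le_integral_norm _).trans
      (integral_mono ((hint x hx).sub (hint y hy)).norm (hYint.const_mul _) fun ω => ?_)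
    refine (abs_exp_neg_sub_exp_neg_le (mul_nonneg hx (hY0 ω)) (mul_nonneg hy (hY0 ω))).trans ?_
    rw [← sub_mul, abs_mul, abs_of_nonneg (hY0 ω)]
  · simp_rw [← hE]
    have h0 : (0 : ℝ) = ∫ _, (0 : ℝ) ∂P := by simp
    rw [h0]
    refine tendsto_integral_filter_of_dominated_convergence (fun _ => 1)
      (Eventually.of_forall hm) ?_ (integrable_const _) ?_
    · filter_upwards [eventually_ge_atTop 0] with x hx using ae_of_all _ (hle x hx)
    · filter_upwards [hK.ae_pos hν one_pos] with ω hω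
      have : 0 < Y ω := by positivity
      exact Real.tendsto_exp_neg_atTop_nhds_zero.comp (tendsto_id.atTop_mul_const this)

/-! ### The random time `H (L t)` -/

section RandomTime

variable {Ω : Type*} [MeasurableSpace Ω] {P : Measure Ω} [IsProbabilityMeasure P]
  {β ν : ℝ} {B : ℝ≥0 → Ω → ℝ} {H K : ℝ≥0 → Ω → ℝ≥0}

/-- The random time `H (L t)` has Laplace transform `γ ↦ E_ν(-γ^β t^ν)` and is independent
of `B`. -/
lemma exists_randomTime (hν : 0 < ν) (hBm : ∀ t, Measurable (B t))
    (hH : IsStableSubordinator β H P) (hK : IsStableSubordinator ν K P)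
    (hind : iIndepFun (β := fun _ : Fin 3 => ℝ≥0 → ℝ)
      ![fun ω t => B t ω, fun ω t => (H t ω : ℝ), fun ω t => (K t ω : ℝ)] P)
    {t : ℝ≥0} (ht : 0 < t) :
    ∃ T : Ω → ℝ≥0, Measurable T ∧ (∀ᵐ ω ∂P, T ω = H (inverseSubordinator K t ω) ω) ∧
      IndepFun (fun ω s => B s ω) T P ∧
      ∀ γ : ℝ, 0 ≤ γ →
        ∫ ω, Real.exp (-(γ * (T ω : ℝ))) ∂P = mittagLeffler ν (-(γ ^ β * (t : ℝ) ^ ν)) := by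
  have hHm : Measurable fun ω s => (H s ω : ℝ) := measurable_pi_lambda _ hH.measurable_real
  have hKm : Measurable fun ω s => (K s ω : ℝ) := measurable_pi_lambda _ hK.measurable_real
  have hBpm : Measurable fun ω s => B s ω := measurable_pi_lambda _ hBm
  have hmeas : ∀ i, Measurable ((![fun ω t => B t ω, fun ω t => (H t ω : ℝ),
      fun ω t => (K t ω : ℝ)] : Fin 3 → Ω → ℝ≥0 → ℝ) i) := by
    intro i
    fin_cases i
    · exact hBpm
    · exact hHm
    · exact hKm
  set τ : Ω → ℝ≥0 := fun ω => pathInverse t (fun s => (K s ω : ℝ))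
  have hτm : Measurable τ := hK.measurable_pathInverse_comp t
  -- A version of `H (L t)` that is a measurable function of the two paths, so that measurability
  -- and independence from `B` follow by composition.
  set Φ : (ℝ≥0 → ℝ) × (ℝ≥0 → ℝ) → ℝ≥0 :=
    fun p => Real.toNNReal (evalRight p.1 (pathInverse t p.2))
  have hΦ : Measurable Φ := by
    have h1 : Measurable fun p : (ℝ≥0 → ℝ) × (ℝ≥0 → ℝ) => (p.1, pathInverse t p.2) :=
      measurable_fst.prodMk ((measurable_pathInverse t).comp measurable_snd)
    exact (measurable_evalRight.comp h1).real_toNNReal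
  have hr : ∀ᵐ ω ∂P, ∀ t, ContinuousWithinAt (fun s => (H s ω : ℝ)) (Ici t) t := by
    filter_upwards [hH.rightCont] with ω hω t
    exact (NNReal.continuous_coe.tendsto _).comp (hω t)
  have hHK : IndepFun (fun ω s => (H s ω : ℝ)) τ P := by
    have h : IndepFun (fun ω s => (H s ω : ℝ)) (fun ω s => (K s ω : ℝ)) P :=
      hind.indepFun (i := 1) (j := 2) (by decide)
    exact h.comp measurable_id (measurable_pathInverse t)
  have hT : ∀ᵐ ω ∂P, Φ (fun s => (H s ω : ℝ), fun s => (K s ω : ℝ)) = H (τ ω) ω := by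
    filter_upwards [ae_evalRight_eq hr] with ω hω
    change Real.toNNReal (evalRight (fun s => (H s ω : ℝ)) (τ ω)) = _
    rw [hω, Real.toNNReal_coe]
  refine ⟨fun ω => Φ (fun s => (H s ω : ℝ), fun s => (K s ω : ℝ)),
    hΦ.comp (hHm.prodMk hKm), ?_, ?_, fun γ hγ => ?_⟩
  · filter_upwards [hT, hK.ae_pathInverse_eq ht] with ω h1 h2
    rw [h1]
    simp only [τ, h2]
  · have h : IndepFun (fun ω => ((fun s => (H s ω : ℝ)), fun s => (K s ω : ℝ)))
        (fun ω s => B s ω) P :=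
      hind.indepFun_prodMk hmeas 1 2 0 (by decide) (by decide)
    exact (h.comp hΦ measurable_id).symm
  · have h1 : ∫⁻ ω, ENNReal.ofReal (Real.exp (-(γ * (H (τ ω) ω : ℝ)))) ∂P =
        ENNReal.ofReal (mittagLeffler ν (-(γ ^ β * (t : ℝ) ^ ν))) := by
      rw [lintegral_randomTime (X := fun s ω => (H s ω : ℝ)) hH.measurable_real hτm hr hHK
        (f := fun x => ENNReal.ofReal (Real.exp (-(γ * x)))) (by fun_prop)]
      simp_rw [hH.lintegral_exp_neg_mul _ hγ]
      rw [← hK.integral_exp_neg_mul_pathInverse hν ht, ofReal_integral_eq_lintegral_ofReal]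
      · simp_rw [mul_comm (γ ^ β)]
        rfl
      · refine Integrable.of_bound
          (measurable_exp_neg_const_mul hτm.coe_nnreal_real _).aestronglyMeasurable 1
          (ae_of_all _ fun ω => ?_)
        rw [Real.norm_of_nonneg (Real.exp_pos _).le, Real.exp_le_one_iff]
        have : 0 ≤ γ ^ β * (τ ω : ℝ) := by positivity
        linarith
      · exact ae_of_all _ fun ω => (Real.exp_pos _).le
    have hTm : Measurable fun ω => Φ (fun s => (H s ω : ℝ), fun s => (K s ω : ℝ)) :=
      hΦ.comp (hHm.prodMk hKm)
    change ∫ ω, Real.exp (-(γ * (Φ (fun s => (H s ω : ℝ), fun s => (K s ω : ℝ)) : ℝ))) ∂P = _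
    rw [integral_eq_lintegral_of_nonneg_ae (ae_of_all _ fun ω => (Real.exp_pos _).le)
      (measurable_exp_neg_const_mul hTm.coe_nnreal_real γ).aestronglyMeasurable]
    rw [← ENNReal.toReal_ofReal ((hK.mittagLefflerBounds hν).nonneg (γ ^ β * (t : ℝ) ^ ν)), ← h1]
    congr 1
    refine lintegral_congr_ae ?_
    filter_upwards [hT] with ω hω
    rw [hω]

end RandomTime

/-! ### Poisson summation and uniform bounds for theta partial sums -/

section Theta

/-- The shape of the dual side of `Complex.tsum_exp_neg_quadratic` with `a = s/(2π)` and `b =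
-iθ/(2π)`. -/
lemma gaussianPDFReal_add_two_pi_mul {s : ℝ≥0} (hs : 0 < s) (θ : ℝ) (n : ℤ) :
    ((gaussianPDFReal 0 s (θ + 2 * Real.pi * n) : ℝ) : ℂ) = ((√(2 * Real.pi * s))⁻¹ : ℝ) *
      Complex.exp (-Real.pi / ((s / (2 * Real.pi) : ℝ) : ℂ) *
        (n + Complex.I * (-(Complex.I * θ / (2 * Real.pi)))) ^ 2) := by
  have hs' : (s : ℂ) ≠ 0 := by exact_mod_cast hs.ne'
  have hpi : (Real.pi : ℂ) ≠ 0 := by exact_mod_cast Real.pi_ne_zero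
  have e : Complex.I * (-(Complex.I * θ / (2 * Real.pi))) = (θ : ℂ) / (2 * Real.pi) := by
    rw [mul_neg, ← mul_div_assoc, ← mul_assoc, Complex.I_mul_I]; ring
  have e2 : -(Real.pi : ℂ) / ((s / (2 * Real.pi) : ℝ) : ℂ) * (n + (θ : ℂ) / (2 * Real.pi)) ^ 2 =
      ((-(θ + 2 * Real.pi * n - 0) ^ 2 / (2 * s) : ℝ) : ℂ) := by
    push_cast
    have hs'' : ((s : ℝ) : ℂ) ≠ 0 := hs'
    field_simp
    ring
  rw [e, e2, gaussianPDFReal_def, ← Complex.ofReal_exp, ← Complex.ofReal_mul]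

lemma jacobiTheta₂_term_eq {s : ℝ≥0} (θ : ℝ) (n : ℤ) :
    jacobiTheta₂_term n (-(θ / (2 * Real.pi) : ℝ)) (Complex.I * (s / (2 * Real.pi) : ℝ)) =
      Complex.exp (-Real.pi * ((s / (2 * Real.pi) : ℝ) : ℂ) * n ^ 2 +
        2 * Real.pi * (-(Complex.I * θ / (2 * Real.pi))) * n) := by
  have hpi : (Real.pi : ℂ) ≠ 0 := by exact_mod_cast Real.pi_ne_zero
  rw [jacobiTheta₂_term]
  congr 1
  push_cast
  have : Complex.I * Complex.I = -1 := Complex.I_mul_I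
  linear_combination (Real.pi : ℂ) * n ^ 2 * (s / (2 * Real.pi)) * this

/-- Expanding `(θ + 2πn)²` exhibits the terms as a constant times those of a Jacobi theta function
with `z = iθ/s`, `τ = 2πi/s`. -/
lemma summable_gaussianPDFReal_add {s : ℝ≥0} (hs : 0 < s) (θ : ℝ) :
    Summable fun n : ℤ => gaussianPDFReal 0 s (θ + 2 * Real.pi * n) := by
  have hs' : (0 : ℝ) < s := by exact_mod_cast hs
  have hpi := Real.pi_pos
  have h := ((summable_jacobiTheta₂_term_iff (Complex.I * (θ / s : ℝ))
    (Complex.I * (2 * Real.pi / s : ℝ))).2 (by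
      rw [Complex.I_mul_im, Complex.ofReal_re]; positivity)).mul_left
      (((√(2 * Real.pi * s))⁻¹ * Real.exp (-θ ^ 2 / (2 * s)) : ℝ) : ℂ)
  rw [← Complex.summable_ofReal]
  refine h.congr fun n => ?_
  rw [jacobiTheta₂_term, gaussianPDFReal_def]
  push_cast
  rw [mul_assoc, ← Complex.exp_add]
  congr 2
  have hs'' : ((s : ℝ) : ℂ) ≠ 0 := by exact_mod_cast hs'.ne'
  have : Complex.I * Complex.I = -1 := Complex.I_mul_I
  field_simp
  linear_combination ((2 * θ + 2 * Real.pi * n) * Real.pi * n * 2) * this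

/-- Poisson summation for the wrapped Gaussian density. -/
lemma hasSum_exp_mul_cos {s : ℝ≥0} (hs : 0 < s) (θ : ℝ) :
    HasSum (fun n : ℤ => Real.exp (-((n : ℝ) ^ 2 / 2 * s)) * Real.cos (n * θ))
      (2 * Real.pi * ∑' n : ℤ, gaussianPDFReal 0 s (θ + 2 * Real.pi * n)) := by
  have hs' : (0 : ℝ) < s := by exact_mod_cast hs
  have hpi := Real.pi_pos
  have ha : 0 < (((s / (2 * Real.pi) : ℝ) : ℂ)).re := by rw [Complex.ofReal_re]; positivity
  have h := Complex.tsum_exp_neg_quadratic ha (-(Complex.I * θ / (2 * Real.pi)))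
  have hsum := hasSum_jacobiTheta₂_term (-(θ / (2 * Real.pi) : ℝ))
    (τ := Complex.I * (s / (2 * Real.pi) : ℝ))
    (by rw [Complex.I_mul_im, Complex.ofReal_re]; positivity)
  simp_rw [jacobiTheta₂_term_eq] at hsum
  rw [← hsum.tsum_eq] at hsum
  rw [h] at hsum
  have hc : ((√(2 * Real.pi * s))⁻¹ : ℝ) ≠ 0 := by positivity
  have e1 : ∀ n : ℤ, Complex.exp (-Real.pi / ((s / (2 * Real.pi) : ℝ) : ℂ) *
        (n + Complex.I * (-(Complex.I * θ / (2 * Real.pi)))) ^ 2) =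
      (((√(2 * Real.pi * s)) * gaussianPDFReal 0 s (θ + 2 * Real.pi * n) : ℝ) : ℂ) := by
    intro n
    rw [Complex.ofReal_mul, gaussianPDFReal_add_two_pi_mul hs, ← mul_assoc, ← Complex.ofReal_mul,
      mul_inv_cancel₀ (by positivity), Complex.ofReal_one, one_mul]
  have e2 : (1 : ℂ) / ((s / (2 * Real.pi) : ℝ) : ℂ) ^ (1 / 2 : ℂ) =
      ((1 / √(s / (2 * Real.pi)) : ℝ) : ℂ) := by
    rw [Real.sqrt_eq_rpow, Complex.ofReal_div (1 : ℝ), Complex.ofReal_cpow (by positivity)]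
    norm_num
  have e3 : √(2 * Real.pi * s) = √(s / (2 * Real.pi)) * (2 * Real.pi) := by
    rw [← Real.sqrt_sq (show 0 ≤ 2 * Real.pi by positivity), ← Real.sqrt_mul (by positivity),
      Real.sqrt_sq (by positivity)]
    congr 1
    field_simp
  have e4 : 1 / √(s / (2 * Real.pi)) * √(2 * Real.pi * s) = 2 * Real.pi := by
    rw [e3]
    have : √(s / (2 * Real.pi)) ≠ 0 := by positivity
    field_simp
  simp_rw [e1] at hsum
  rw [e2, ← Complex.ofReal_tsum, tsum_mul_left, ← Complex.ofReal_mul, ← mul_assoc, e4] at hsum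
  have hre := Complex.hasSum_re hsum
  rw [Complex.ofReal_re] at hre
  convert hre using 2 with n
  have e5 : -Real.pi * ((s / (2 * Real.pi) : ℝ) : ℂ) * n ^ 2 +
        2 * Real.pi * (-(Complex.I * θ / (2 * Real.pi))) * n =
      ((-((n : ℝ) ^ 2 / 2 * s) : ℝ) : ℂ) + ((-(n * θ) : ℝ) : ℂ) * Complex.I := by
    have hpi' : (Real.pi : ℂ) ≠ 0 := by exact_mod_cast hpi.ne'
    push_cast
    field_simp
  rw [e5, Complex.exp_add, ← Complex.ofReal_exp, Complex.re_ofReal_mul,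
    Complex.exp_ofReal_mul_I_re, Real.cos_neg]

/-- Partial sums of the Fourier series of the wrapped Gaussian density of variance `s`. -/
noncomputable def thetaPartialSum (s θ : ℝ) (N : ℕ) : ℝ :=
  1 / (2 * Real.pi) + 1 / Real.pi * ∑ k ∈ Finset.Icc 1 N,
    Real.exp (-((k : ℝ) ^ 2 / 2 * s)) * Real.cos (k * θ)

/-- The wrapped Gaussian density. -/
noncomputable def wrappedGaussian (s : ℝ≥0) (θ : ℝ) : ℝ :=
  ∑' n : ℤ, gaussianPDFReal 0 s (θ + 2 * Real.pi * n)

lemma wrappedGaussian_nonneg (s : ℝ≥0) (θ : ℝ) : 0 ≤ wrappedGaussian s θ :=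
  tsum_nonneg fun _ => gaussianPDFReal_nonneg _ _ _

lemma sum_Icc_one_eq_sum_range (f : ℕ → ℝ) (N : ℕ) :
    ∑ k ∈ Finset.Icc 1 N, f k = ∑ k ∈ Finset.range N, f (k + 1) := by
  induction N with
  | zero => simp
  | succ m ih => rw [Finset.sum_Icc_succ_top (by omega), Finset.sum_range_succ, ih]

lemma tendsto_thetaPartialSum {s : ℝ≥0} (hs : 0 < s) (θ : ℝ) :
    Tendsto (thetaPartialSum s θ) atTop (𝓝 (wrappedGaussian s θ)) := by
  have hpi := Real.pi_pos
  -- Pairing `n` with `-n` counts the term `n = 0`, equal to `1`, twice; hence the subtraction of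
  -- `1`.
  have h := (hasSum_exp_mul_cos hs θ).nat_add_neg
  have h2 := (h.tendsto_sum_nat.comp (tendsto_add_atTop_nat 1)).sub_const 1
  have h3 := h2.const_mul (1 / (2 * Real.pi))
  have e1 : 1 / (2 * Real.pi) * (2 * Real.pi * wrappedGaussian s θ +
      Real.exp (-(((0 : ℤ) : ℝ) ^ 2 / 2 * s)) * Real.cos ((0 : ℤ) * θ) - 1) =
      wrappedGaussian s θ := by
    simp only [Int.cast_zero, ne_eq, OfNat.ofNat_ne_zero, not_false_eq_true, zero_pow, zero_div,
      zero_mul, neg_zero, Real.exp_zero, Real.cos_zero, mul_one, add_sub_cancel_right]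
    field_simp
  rw [wrappedGaussian] at e1 ⊢
  rw [e1] at h3
  refine h3.congr fun N => ?_
  rw [Function.comp_apply, Finset.sum_range_succ', thetaPartialSum, sum_Icc_one_eq_sum_range]
  have e2 : ∀ k : ℕ, Real.exp (-((((k + 1 : ℕ) : ℤ) : ℝ) ^ 2 / 2 * s)) *
      Real.cos ((((k + 1 : ℕ) : ℤ) : ℝ) * θ) +
      Real.exp (-(((-((k + 1 : ℕ) : ℤ) : ℤ) : ℝ) ^ 2 / 2 * s)) *
      Real.cos (((-((k + 1 : ℕ) : ℤ) : ℤ) : ℝ) * θ) =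
      2 * (Real.exp (-(((k + 1 : ℕ) : ℝ) ^ 2 / 2 * s)) * Real.cos (((k + 1 : ℕ) : ℝ) * θ)) := by
    intro k
    rw [Int.cast_neg, Int.cast_natCast, neg_sq, neg_mul, Real.cos_neg]
    ring
  simp_rw [e2]
  rw [← Finset.mul_sum]
  generalize Finset.sum (M := ℝ) (Finset.range N) _ = S
  simp
  field_simp
  ring

/-- Dirichlet's bound. -/
lemma abs_sum_cos_le {θ : ℝ} (hθ : 0 < Real.sin (θ / 2)) (n : ℕ) :
    |∑ k ∈ Finset.Icc 1 n, Real.cos (k * θ)| ≤ 1 / Real.sin (θ / 2) := by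
  -- Telescoping of `2 sin (θ/2) cos kθ = sin ((k + 1/2)θ) - sin ((k - 1/2)θ)`.
  have h : 2 * Real.sin (θ / 2) * ∑ k ∈ Finset.Icc 1 n, Real.cos (k * θ) =
      Real.sin ((n + 1 / 2) * θ) - Real.sin (θ / 2) := by
    induction n with
    | zero => simp; ring_nf
    | succ m ih =>
      rw [Finset.sum_Icc_succ_top (by omega), mul_add, ih]
      have e1 : ((m + 1 : ℕ) + 1 / 2 : ℝ) * θ = (m + 1 : ℕ) * θ + θ / 2 := by ring
      have e2 : ((m : ℝ) + 1 / 2) * θ = (m + 1 : ℕ) * θ - θ / 2 := by push_cast; ring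
      rw [e1, e2, Real.sin_add, Real.sin_sub]
      ring
  rw [le_div_iff₀ hθ, ← abs_of_pos hθ, ← abs_mul]
  have h1 := Real.abs_sin_le_one ((n + 1 / 2) * θ)
  have h2 := Real.abs_sin_le_one (θ / 2)
  rw [abs_le] at *
  constructor <;> nlinarith

/-- Abel's inequality. -/
lemma abs_sum_mul_le {a d : ℕ → ℝ} (ha : Antitone a) (ha0 : ∀ n, 0 ≤ a n) {M : ℝ}
    (hd : ∀ n, |∑ k ∈ Finset.Icc 1 n, d k| ≤ M) (N : ℕ) :
    |∑ k ∈ Finset.Icc 1 N, a k * d k| ≤ a 0 * M := by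
  have h : |∑ k ∈ Finset.Icc 1 N, a k * d k - a N * ∑ k ∈ Finset.Icc 1 N, d k| ≤
      (a 0 - a N) * M := by
    induction N with
    | zero => simp
    | succ m ih =>
      rw [Finset.sum_Icc_succ_top (by omega), Finset.sum_Icc_succ_top (by omega)]
      have e : ∑ k ∈ Finset.Icc 1 m, a k * d k + a (m + 1) * d (m + 1) -
          a (m + 1) * (∑ k ∈ Finset.Icc 1 m, d k + d (m + 1)) =
          (∑ k ∈ Finset.Icc 1 m, a k * d k - a m * ∑ k ∈ Finset.Icc 1 m, d k) +
          (a m - a (m + 1)) * ∑ k ∈ Finset.Icc 1 m, d k := by ring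
      rw [e]
      have h1 : 0 ≤ a m - a (m + 1) := sub_nonneg.2 (ha m.le_succ)
      calc _ ≤ _ := abs_add_le _ _
        _ ≤ (a 0 - a m) * M + (a m - a (m + 1)) * M := by
            rw [abs_mul, abs_of_nonneg h1]
            gcongr
            exact hd m
        _ = _ := by ring
  have h2 : |a N * ∑ k ∈ Finset.Icc 1 N, d k| ≤ a N * M := by
    rw [abs_mul, abs_of_nonneg (ha0 N)]
    exact mul_le_mul_of_nonneg_left (hd N) (ha0 N)
  calc |∑ k ∈ Finset.Icc 1 N, a k * d k| = |(∑ k ∈ Finset.Icc 1 N, a k * d k -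
        a N * ∑ k ∈ Finset.Icc 1 N, d k) + a N * ∑ k ∈ Finset.Icc 1 N, d k| := by ring_nf
    _ ≤ (a 0 - a N) * M + a N * M := (abs_add_le _ _).trans (add_le_add h h2)
    _ = a 0 * M := by ring

/-- The coefficients `exp (-k²s/2)` decrease in `k` from the value `1` at `k = 0`, so Abel's
inequality gives a bound free of `s` and `N`: the dominating constant for averaging over a random
variance. -/
lemma abs_thetaPartialSum_le {θ : ℝ} (hθ : 0 < Real.sin (θ / 2)) {s : ℝ} (hs : 0 ≤ s) (N : ℕ) :
    |thetaPartialSum s θ N| ≤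
      1 / (2 * Real.pi) + 1 / Real.pi * (1 / Real.sin (θ / 2)) := by
  have hpi := Real.pi_pos
  have h := abs_sum_mul_le (a := fun k : ℕ => Real.exp (-((k : ℝ) ^ 2 / 2 * s)))
    (d := fun k : ℕ => Real.cos (k * θ)) (fun m n hmn => by dsimp only; gcongr)
    (fun n => (Real.exp_pos _).le) (abs_sum_cos_le hθ) N
  simp only [CharP.cast_eq_zero, ne_eq, OfNat.ofNat_ne_zero, not_false_eq_true, zero_pow, zero_div,
    zero_mul, neg_zero, Real.exp_zero, one_mul] at h
  rw [thetaPartialSum]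
  refine (abs_add_le _ _).trans ?_
  rw [abs_of_pos (by positivity : 0 < 1 / (2 * Real.pi)), abs_mul,
    abs_of_pos (by positivity : 0 < 1 / Real.pi)]
  gcongr

end Theta

/-! ### Folding the Gaussian law onto the circle -/

section Wrap

lemma measurable_toIcoMod_two_pi : Measurable (toIcoMod Real.two_pi_pos 0) := by
  have : toIcoMod Real.two_pi_pos 0 = fun b : ℝ => b - ⌊(b - 0) / (2 * Real.pi)⌋ •
      (2 * Real.pi) := by
    ext b
    rw [toIcoMod, toIcoDiv_eq_floor]
  rw [this]
  simp only [zsmul_eq_mul]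
  fun_prop

lemma lintegral_eq_lintegral_Ico_tsum {g : ℝ → ℝ≥0∞} (hg : Measurable g) :
    ∫⁻ x, g x = ∫⁻ θ in Ico 0 (2 * Real.pi), ∑' n : ℤ, g (θ + 2 * Real.pi * n) := by
  rw [lintegral_tsum fun n => Measurable.aemeasurable (by fun_prop), ← setLIntegral_univ,
    ← iUnion_Ico_add_zsmul Real.two_pi_pos 0,
    lintegral_iUnion (fun _ => measurableSet_Ico) (pairwise_disjoint_Ico_add_zsmul _ _)]
  refine tsum_congr fun n => ?_
  have h := (measurePreserving_add_right (volume : Measure ℝ) (2 * Real.pi * n)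
    ).setLIntegral_comp_preimage
    (s := Ico (0 + n • (2 * Real.pi)) (0 + (n + 1) • (2 * Real.pi))) measurableSet_Ico hg
  rw [← h]
  congr 2
  ext x
  simp only [mem_preimage, mem_Ico, zsmul_eq_mul]
  push_cast
  constructor <;> rintro ⟨h1, h2⟩ <;> constructor <;> linarith

lemma lintegral_wrap_gaussianReal {s : ℝ≥0} (hs : 0 < s) {f : ℝ → ℝ≥0∞} (hf : Measurable f) :
    ∫⁻ x, f (toIcoMod Real.two_pi_pos 0 x) ∂(gaussianReal 0 s) =
      ∫⁻ θ in Ico 0 (2 * Real.pi), ENNReal.ofReal (wrappedGaussian s θ) * f θ := by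
  have hfm := hf.comp measurable_toIcoMod_two_pi
  have hm : Measurable fun x => f (toIcoMod Real.two_pi_pos 0 x) := hfm
  have hgm := measurable_gaussianPDF 0 s
  rw [gaussianReal_of_var_ne_zero 0 hs.ne', lintegral_withDensity_eq_lintegral_mul _ hgm hm,
    lintegral_eq_lintegral_Ico_tsum (hgm.mul hm)]
  refine setLIntegral_congr_fun measurableSet_Ico fun θ hθ => ?_
  rw [wrappedGaussian, ENNReal.ofReal_tsum_of_nonneg (fun _ => gaussianPDFReal_nonneg _ _ _)
    (summable_gaussianPDFReal_add hs θ), ← ENNReal.tsum_mul_right]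
  refine tsum_congr fun n => ?_
  have e : toIcoMod Real.two_pi_pos 0 (θ + 2 * Real.pi * n) = θ := by
    have := toIcoMod_add_zsmul Real.two_pi_pos 0 θ n
    rw [zsmul_eq_mul, mul_comm (n : ℝ)] at this
    rw [this, toIcoMod_eq_self]
    simpa using hθ
  simp only [Pi.mul_apply, e]
  rfl

end Wrap

/-! ### The density as an average of wrapped Gaussians -/

variable {Ω : Type*} [MeasurableSpace Ω] {P : Measure Ω}
  {β ν : ℝ}

/-- `T` has the Laplace transform `γ ↦ E_ν(-γ^β t^ν)` of `H (L t)`. -/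
structure IsMLTime (ν β t : ℝ) (T : Ω → ℝ≥0) (P : Measure Ω) : Prop where
  measurable : Measurable T
  laplace : ∀ γ : ℝ, 0 ≤ γ →
    ∫ ω, Real.exp (-(γ * (T ω : ℝ))) ∂P = mittagLeffler ν (-(γ ^ β * t ^ ν))

namespace IsMLTime

variable {T : Ω → ℝ≥0} {t : ℝ}

lemma integrable_exp [IsProbabilityMeasure P] (hT : IsMLTime ν β t T P) {γ : ℝ} (hγ : 0 ≤ γ) :
    Integrable (fun ω => Real.exp (-(γ * (T ω : ℝ)))) P := by
  refine Integrable.of_bound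
    (measurable_exp_neg_const_mul hT.measurable.coe_nnreal_real γ).aestronglyMeasurable 1
    (ae_of_all _ fun ω => ?_)
  rw [Real.norm_of_nonneg (Real.exp_pos _).le, Real.exp_le_one_iff]
  have : 0 ≤ γ * (T ω : ℝ) := by positivity
  linarith

/-- `P(T = 0) ≤ E exp (-nT) = E_ν(-n^β t^ν) → 0`. Poisson summation requires this positive variance.
-/
lemma ae_pos [IsProbabilityMeasure P]
    (hT : IsMLTime ν β t T P) (hβ : 0 < β) (ht : 0 < t) (hE : MittagLefflerBounds ν) :
    ∀ᵐ ω ∂P, 0 < T ω := by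
  have hm : MeasurableSet {ω | ¬ 0 < T ω} :=
    (measurableSet_lt measurable_const hT.measurable).compl
  have h1 : ∀ n : ℕ, P.real {ω | ¬ 0 < T ω} ≤ mittagLeffler ν (-((n : ℝ) ^ β * t ^ ν)) := by
    intro n
    rw [← hT.laplace n (Nat.cast_nonneg n), ← integral_indicator_one hm]
    refine integral_mono ((integrable_const (1 : ℝ)).indicator hm)
      (hT.integrable_exp (Nat.cast_nonneg n)) (indicator_le' (fun ω hω => ?_) fun ω _ =>
        (Real.exp_pos _).le)
    have : T ω = 0 := le_antisymm (not_lt.1 hω) zero_le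
    simp [this]
  have h2 : Tendsto (fun n : ℕ => mittagLeffler ν (-((n : ℝ) ^ β * t ^ ν))) atTop (𝓝 0) :=
    hE.tendsto.comp (((tendsto_rpow_atTop hβ).comp tendsto_natCast_atTop_atTop).atTop_mul_const
      (Real.rpow_pos_of_pos ht ν))
  have h3 : P.real {ω | ¬ 0 < T ω} = 0 := le_antisymm (ge_of_tendsto' h2 h1) measureReal_nonneg
  rwa [measureReal_eq_zero_iff] at h3

lemma densityPartialSum_eq [IsProbabilityMeasure P] (hT : IsMLTime ν β t T P) (θ : ℝ) (N : ℕ) :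
    densityPartialSum ν β θ t N = ∫ ω, thetaPartialSum (T ω) θ N ∂P := by
  simp only [densityPartialSum, thetaPartialSum]
  have hint : ∀ k : ℕ, Integrable
      (fun ω => Real.exp (-((k : ℝ) ^ 2 / 2 * (T ω : ℝ))) * Real.cos (k * θ)) P := fun k =>
    (hT.integrable_exp (by positivity)).mul_const _
  rw [integral_add (integrable_const _)
    ((integrable_finsetSum _ fun k _ => hint k).const_mul _), integral_const_mul,
    integral_finsetSum _ fun k _ => hint k]
  simp only [integral_const, probReal_univ, one_smul]
  congr 2
  refine Finset.sum_congr rfl fun k _ => ?_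
  rw [integral_mul_const, hT.laplace _ (by positivity)]

lemma measurable_thetaPartialSum (hT : IsMLTime ν β t T P) (θ : ℝ) (N : ℕ) :
    Measurable fun ω => thetaPartialSum (T ω) θ N := by
  have := hT.measurable
  unfold thetaPartialSum
  fun_prop

end IsMLTime

lemma sin_half_pos {θ : ℝ} (hθ : θ ∈ Ioo 0 (2 * Real.pi)) : 0 < Real.sin (θ / 2) :=
  Real.sin_pos_of_pos_of_lt_pi (by linarith [hθ.1]) (by linarith [hθ.2])

/-- The extended nonnegative sum is jointly measurable without any summability, including at
variance `0`. -/
lemma measurable_wrappedGaussian : Measurable fun p : ℝ≥0 × ℝ =>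
    ∑' n : ℤ, gaussianPDF 0 p.1 (p.2 + 2 * Real.pi * n) := by
  refine Measurable.tsum fun n => ?_
  simp only [gaussianPDF, gaussianPDFReal]
  fun_prop

lemma ofReal_wrappedGaussian {s : ℝ≥0} (hs : 0 < s) (θ : ℝ) :
    ENNReal.ofReal (wrappedGaussian s θ) = ∑' n : ℤ, gaussianPDF 0 s (θ + 2 * Real.pi * n) := by
  rw [wrappedGaussian, ENNReal.ofReal_tsum_of_nonneg (fun _ => gaussianPDFReal_nonneg _ _ _)
    (summable_gaussianPDFReal_add hs θ)]
  rfl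

namespace IsMLTime

variable {T : Ω → ℝ≥0} {t : ℝ}

lemma ae_abs_wrappedGaussian_le (hpos : ∀ᵐ ω ∂P, 0 < T ω) {θ : ℝ}
    (hθ : θ ∈ Ioo 0 (2 * Real.pi)) :
    ∀ᵐ ω ∂P, ‖wrappedGaussian (T ω) θ‖ ≤
      1 / (2 * Real.pi) + 1 / Real.pi * (1 / Real.sin (θ / 2)) := by
  filter_upwards [hpos] with ω hω
  exact le_of_tendsto (tendsto_thetaPartialSum hω θ).norm
    (Eventually.of_forall fun N => abs_thetaPartialSum_le (sin_half_pos hθ) NNReal.zero_le_coe N)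

lemma aestronglyMeasurable_wrappedGaussian (hT : IsMLTime ν β t T P)
    (hpos : ∀ᵐ ω ∂P, 0 < T ω) (θ : ℝ) :
    AEStronglyMeasurable (fun ω => wrappedGaussian (T ω) θ) P :=
  aestronglyMeasurable_of_tendsto_ae atTop
    (fun N => (hT.measurable_thetaPartialSum θ N).aestronglyMeasurable)
    (hpos.mono fun _ hω => tendsto_thetaPartialSum hω θ)

/-- Convergence of the Fourier series away from `θ = 0`. -/
lemma tendsto_densityPartialSum [IsProbabilityMeasure P]
    (hT : IsMLTime ν β t T P) (hpos : ∀ᵐ ω ∂P, 0 < T ω) {θ : ℝ}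
    (hθ : θ ∈ Ioo 0 (2 * Real.pi)) :
    Tendsto (densityPartialSum ν β θ t) atTop (𝓝 (∫ ω, wrappedGaussian (T ω) θ ∂P)) := by
  have e : densityPartialSum ν β θ t = fun N => ∫ ω, thetaPartialSum (T ω) θ N ∂P :=
    funext (hT.densityPartialSum_eq θ)
  rw [e]
  exact tendsto_integral_of_dominated_convergence
    (fun _ => 1 / (2 * Real.pi) + 1 / Real.pi * (1 / Real.sin (θ / 2)))
    (fun N => (hT.measurable_thetaPartialSum θ N).aestronglyMeasurable) (integrable_const _)
    (fun N => ae_of_all _ fun ω =>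
      abs_thetaPartialSum_le (sin_half_pos hθ) NNReal.zero_le_coe N)
    (hpos.mono fun _ hω => tendsto_thetaPartialSum hω θ)

lemma density_eq [IsProbabilityMeasure P]
    (hT : IsMLTime ν β t T P) (hpos : ∀ᵐ ω ∂P, 0 < T ω) {θ : ℝ}
    (hθ : θ ∈ Ioo 0 (2 * Real.pi)) :
    density ν β θ t = ∫ ω, wrappedGaussian (T ω) θ ∂P :=
  (hT.tendsto_densityPartialSum hpos hθ).limUnder_eq

lemma ofReal_density [IsProbabilityMeasure P]
    (hT : IsMLTime ν β t T P) (hpos : ∀ᵐ ω ∂P, 0 < T ω) {θ : ℝ}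
    (hθ : θ ∈ Ioo 0 (2 * Real.pi)) :
    ENNReal.ofReal (density ν β θ t) =
      ∫⁻ ω, ∑' n : ℤ, gaussianPDF 0 (T ω) (θ + 2 * Real.pi * n) ∂P := by
  rw [hT.density_eq hpos hθ, ofReal_integral_eq_lintegral_ofReal
    (Integrable.of_bound (hT.aestronglyMeasurable_wrappedGaussian hpos θ) _
      (ae_abs_wrappedGaussian_le hpos hθ)) (ae_of_all _ fun ω => wrappedGaussian_nonneg _ _)]
  exact lintegral_congr_ae (hpos.mono fun ω hω => ofReal_wrappedGaussian hω θ)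

/-- Only `θ = 0` is lost, where the series may diverge; it is a null set. -/
lemma ae_ofReal_density [IsProbabilityMeasure P]
    (hT : IsMLTime ν β t T P) (hpos : ∀ᵐ ω ∂P, 0 < T ω) :
    (fun θ => ENNReal.ofReal (density ν β θ t)) =ᵐ[volume.restrict (Ico 0 (2 * Real.pi))]
      fun θ => ∫⁻ ω, ∑' n : ℤ, gaussianPDF 0 (T ω) (θ + 2 * Real.pi * n) ∂P := by
  rw [← restrict_Ioo_eq_restrict_Ico]
  exact (ae_restrict_iff' measurableSet_Ioo).2 (ae_of_all _ fun θ hθ => hT.ofReal_density hpos hθ)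

/-- The law of a Brownian motion at an independent random time, wrapped around the circle. -/
lemma hasLaw_wrap [IsProbabilityMeasure P]
    (hT : IsMLTime ν β t T P) (hpos : ∀ᵐ ω ∂P, 0 < T ω) {B : ℝ≥0 → Ω → ℝ}
    (hBm : ∀ t, Measurable (B t)) (hB : IsBrownianReal B P)
    (hind : IndepFun (fun ω s => B s ω) T P) :
    HasLaw (fun ω => wrap B (T ω) ω)
      ((volume.restrict (Ico (0 : ℝ) (2 * Real.pi))).withDensity
        fun θ => ENNReal.ofReal (density ν β θ t)) P := by
  have hr : ∀ᵐ ω ∂P, ∀ t, ContinuousWithinAt (fun s => B s ω) (Ici t) t :=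
    hB.cont.mono fun ω hω t => hω.continuousWithinAt
  have hae : AEMeasurable (fun ω => wrap B (T ω) ω) P :=
    measurable_toIcoMod_two_pi.comp_aemeasurable (aemeasurable_randomTime hBm hT.measurable hr)
  refine ⟨hae, ?_⟩
  ext A hA
  rw [Measure.map_apply_of_aemeasurable hae hA, withDensity_apply _ hA,
    lintegral_congr_ae (ae_restrict_of_ae (hT.ae_ofReal_density hpos)),
    ← lintegral_indicator hA]
  have hind1 : Measurable (A.indicator (1 : ℝ → ℝ≥0∞)) := measurable_one.indicator hA
  have h1 : P ((fun ω => wrap B (T ω) ω) ⁻¹' A) =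
      ∫⁻ ω, A.indicator 1 (toIcoMod Real.two_pi_pos 0 (B (T ω) ω)) ∂P := by
    rw [← lintegral_indicator_one₀ (hae.nullMeasurableSet_preimage hA)]
    rfl
  rw [h1, lintegral_randomTime hBm hT.measurable hr hind
    (f := fun x => A.indicator 1 (toIcoMod Real.two_pi_pos 0 x))
    (hind1.comp measurable_toIcoMod_two_pi)]
  have h2 : ∀ᵐ ω ∂P, ∫⁻ ω', A.indicator 1 (toIcoMod Real.two_pi_pos 0 (B (T ω) ω')) ∂P =
      ∫⁻ θ in Ico 0 (2 * Real.pi),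
        (∑' n : ℤ, gaussianPDF 0 (T ω) (θ + 2 * Real.pi * n)) * A.indicator 1 θ := by
    filter_upwards [hpos] with ω hω
    have h3 := lintegral_map (μ := P)
      (f := fun x => A.indicator (1 : ℝ → ℝ≥0∞) (toIcoMod Real.two_pi_pos 0 x))
      (hind1.comp measurable_toIcoMod_two_pi) (hBm (T ω))
    rw [← h3, (hB.hasLaw_eval (T ω)).map_eq, lintegral_wrap_gaussianReal hω hind1]
    simp_rw [ofReal_wrappedGaussian hω]
  rw [lintegral_congr_ae h2, lintegral_lintegral_swap]
  · refine lintegral_congr fun θ => ?_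
    by_cases h : θ ∈ A <;> simp [h]
  · refine Measurable.aemeasurable (Measurable.mul ?_ (hind1.comp measurable_snd))
    exact measurable_wrappedGaussian.comp
      ((hT.measurable.comp measurable_fst).prodMk measurable_snd)

end IsMLTime

/-! ### The series at `θ = 0` -/

lemma densityPartialSum_zero (ν β t : ℝ) (N : ℕ) :
    densityPartialSum ν β 0 t N = 1 / (2 * Real.pi) + 1 / Real.pi * ∑ k ∈ Finset.range N,
      mittagLeffler ν (-((((k + 1 : ℕ) : ℝ) ^ 2 / 2) ^ β * t ^ ν)) := by
  rw [densityPartialSum, sum_Icc_one_eq_sum_range]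
  simp

/-- At `θ = 0` the series converges as soon as its coefficients are summable. -/
lemma tendsto_densityPartialSum_zero {ν β t : ℝ} (hE : MittagLefflerBounds ν)
    (hs : Summable fun k : ℕ => mittagLeffler ν (-(((k : ℝ) ^ 2 / 2) ^ β * t ^ ν))) :
    Tendsto (densityPartialSum ν β 0 t) atTop (𝓝 (density ν β 0 t)) ∧ 0 ≤ density ν β 0 t := by
  have hpi := Real.pi_pos
  have h1 := (summable_nat_add_iff 1).2 hs
  have h2 := (h1.hasSum.tendsto_sum_nat.const_mul (1 / Real.pi)).const_add (1 / (2 * Real.pi))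
  have h3 := h2.congr fun N => (densityPartialSum_zero ν β t N).symm
  have h4 : density ν β 0 t = _ := h3.limUnder_eq
  rw [h4]
  refine ⟨h3, ?_⟩
  have : 0 ≤ ∑' k : ℕ, mittagLeffler ν (-((((k + 1 : ℕ) : ℝ) ^ 2 / 2) ^ β * t ^ ν)) :=
    tsum_nonneg fun k => hE.nonneg _
  positivity

lemma summable_exp_neg_rpow {β c : ℝ} (hβ : 0 < β) (hc : 0 < c) :
    Summable fun k : ℕ => Real.exp (-(((k : ℝ) ^ 2 / 2) ^ β * c)) := by
  have h0 : Tendsto (fun k : ℕ => (k : ℝ) ^ 2 / 2) atTop atTop :=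
    ((tendsto_pow_atTop two_ne_zero).comp tendsto_natCast_atTop_atTop).atTop_div_const two_pos
  -- The power `-1/β` is the one that turns `(k²/2)^β` into `2/k²`.
  have h1 := (isLittleO_exp_neg_mul_rpow_atTop hc (-β⁻¹)).comp_tendsto
    ((tendsto_rpow_atTop hβ).comp h0)
  refine summable_of_isBigO_nat (g := fun k : ℕ => 2 * ((k : ℝ) ^ 2)⁻¹)
    ((Real.summable_nat_pow_inv.2 one_lt_two).mul_left 2) ?_
  refine (h1.isBigO.congr (fun k => ?_) fun k => ?_)
  · simp only [Function.comp_apply]; ring_nf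
  · simp only [Function.comp_apply]
    rw [← Real.rpow_mul (by positivity), mul_neg, mul_inv_cancel₀ hβ.ne', Real.rpow_neg_one,
      inv_div]
    ring

lemma summable_inv_rpow {β : ℝ} (hβ : 1 / 2 < β) :
    Summable fun k : ℕ => (((k : ℝ) ^ 2 / 2) ^ β)⁻¹ := by
  have h := (Real.summable_nat_rpow_inv (p := 2 * β)).2 (by linarith)
  refine (h.mul_left (2 ^ β)).congr fun k => ?_
  rw [Real.div_rpow (by positivity) (by positivity), inv_div, ← Real.rpow_natCast,
    ← Real.rpow_mul (Nat.cast_nonneg k)]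
  norm_num
  rfl

/-! ### Pairing the density with trigonometric series -/

section Pairing

variable {Ω : Type*} [MeasurableSpace Ω] {P : Measure Ω}

lemma integral_cos_gaussianReal (k δ : ℝ) (s : ℝ≥0) :
    ∫ x, Real.cos (k * x + δ) ∂(gaussianReal 0 s) =
      Real.cos δ * Real.exp (-(k ^ 2 / 2 * s)) := by
  have h := charFun_gaussianReal (μ := 0) (v := s) k
  rw [charFun_apply_real] at h
  have h2 : ∀ x : ℝ, Real.cos (k * x + δ) =
      (Complex.exp (δ * Complex.I) * Complex.exp (k * x * Complex.I)).re := by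
    intro x
    rw [← Complex.exp_add, ← add_mul, ← Complex.ofReal_mul, ← Complex.ofReal_add,
      Complex.exp_ofReal_mul_I_re, add_comm]
  have hint : Integrable (fun x : ℝ =>
      Complex.exp (δ * Complex.I) * Complex.exp (k * x * Complex.I)) (gaussianReal 0 s) := by
    refine Integrable.of_bound (by fun_prop) 1 (ae_of_all _ fun x => ?_)
    rw [← Complex.ofReal_mul, norm_mul, Complex.norm_exp_ofReal_mul_I,
      Complex.norm_exp_ofReal_mul_I, one_mul]
  simp_rw [h2]
  have h3 := integral_re (𝕜 := ℂ) hint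
  simp only [RCLike.re_eq_complex_re] at h3
  rw [h3, integral_const_mul, h]
  have e : (k : ℂ) * (0 : ℝ) * Complex.I - s * k ^ 2 / 2 = ((-(k ^ 2 / 2 * s) : ℝ) : ℂ) := by
    push_cast; ring
  rw [e, ← Complex.ofReal_exp, mul_comm, Complex.re_ofReal_mul, Complex.exp_ofReal_mul_I_re,
    mul_comm]

/-- Conditioning on an independent random time, for bounded functions. -/
lemma integral_randomTime [IsProbabilityMeasure P]
    {X : ℝ≥0 → Ω → ℝ} {τ : Ω → ℝ≥0} (hX : ∀ t, Measurable (X t))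
    (hτ : Measurable τ) (hr : ∀ᵐ ω ∂P, ∀ t, ContinuousWithinAt (fun s => X s ω) (Ici t) t)
    (hind : IndepFun (fun ω t => X t ω) τ P) {f : ℝ → ℝ} (hf : Measurable f)
    (hf1 : ∀ x, |f x| ≤ 1) :
    ∫ ω, f (X (τ ω) ω) ∂P = ∫ ω', ∫ ω, f (X (τ ω') ω) ∂P ∂P := by
  have hev := ae_evalRight_eq hr
  have hpath : Measurable fun ω t => X t ω := measurable_pi_lambda _ hX
  have := Measure.isProbabilityMeasure_map (μ := P) hpath.aemeasurable
  have := Measure.isProbabilityMeasure_map (μ := P) hτ.aemeasurable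
  set g : (ℝ≥0 → ℝ) × ℝ≥0 → ℝ := fun p => f (evalRight p.1 p.2)
  have hg : Measurable g := hf.comp measurable_evalRight
  have h1 : ∫ ω, f (X (τ ω) ω) ∂P = ∫ ω, g ((fun s => X s ω), τ ω) ∂P :=
    integral_congr_ae (hev.mono fun ω hω => by simp only [g, hω])
  have h2 : ∀ s, ∫ ω, f (X s ω) ∂P = ∫ h, g (h, s) ∂(P.map fun ω t => X t ω) := by
    intro s
    have hm : Measurable fun h => g (h, s) := hg.comp measurable_prodMk_right
    rw [integral_map hpath.aemeasurable hm.aestronglyMeasurable]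
    exact integral_congr_ae (hev.mono fun ω hω => by simp only [g, hω])
  simp_rw [h1, h2]
  have hpair : Measurable fun ω => ((fun s => X s ω), τ ω) := hpath.prodMk hτ
  rw [← integral_map hpair.aemeasurable hg.aestronglyMeasurable,
    (indepFun_iff_map_prod_eq_prod_map_map hpath.aemeasurable hτ.aemeasurable).1 hind,
    integral_prod_symm _ (Integrable.of_bound hg.aestronglyMeasurable 1
      (ae_of_all _ fun p => hf1 _)),
    integral_map hτ.aemeasurable
      hg.stronglyMeasurable.integral_prod_left'.aestronglyMeasurable]

/-- An integer frequency does not see the wrapping, so the mean is that of the motion on the line;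
the centred Gaussian has a real characteristic function, hence the factor `cos δ`. -/
lemma IsMLTime.integral_cos_wrap [IsProbabilityMeasure P]
    {ν β t : ℝ} {T : Ω → ℝ≥0} (hT : IsMLTime ν β t T P)
    {B : ℝ≥0 → Ω → ℝ} (hBm : ∀ t, Measurable (B t)) (hB : IsBrownianReal B P)
    (hind : IndepFun (fun ω s => B s ω) T P) (k : ℤ) (δ : ℝ) :
    ∫ ω, Real.cos (k * wrap B (T ω) ω + δ) ∂P =
      Real.cos δ * mittagLeffler ν (-(((k : ℝ) ^ 2 / 2) ^ β * t ^ ν)) := by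
  have hr : ∀ᵐ ω ∂P, ∀ t, ContinuousWithinAt (fun s => B s ω) (Ici t) t :=
    hB.cont.mono fun ω hω t => hω.continuousWithinAt
  have h1 : ∀ ω, Real.cos (k * wrap B (T ω) ω + δ) = Real.cos (k * B (T ω) ω + δ) := by
    intro ω
    rw [wrap, toIcoMod, zsmul_eq_mul]
    rw [← Real.cos_sub_int_mul_two_pi (k * B (T ω) ω + δ)
      (k * toIcoDiv Real.two_pi_pos 0 (B (T ω) ω))]
    congr 1
    push_cast
    ring
  simp_rw [h1]
  rw [integral_randomTime (f := fun x => Real.cos (k * x + δ)) hBm hT.measurable hr hind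
    (by fun_prop) (fun x => Real.abs_cos_le_one _)]
  have h2 : ∀ s, ∫ ω, Real.cos (k * B s ω + δ) ∂P =
      Real.cos δ * Real.exp (-((k : ℝ) ^ 2 / 2 * s)) := by
    intro s
    rw [← integral_cos_gaussianReal, ← (hB.hasLaw_eval s).map_eq,
      integral_map (hBm s).aemeasurable (Measurable.aestronglyMeasurable (by fun_prop))]
  simp_rw [h2]
  rw [integral_const_mul, hT.laplace _ (by positivity)]

lemma intervalIntegrable_density [IsProbabilityMeasure P] {ν β t : ℝ} {X : Ω → ℝ}
    (hX : HasLaw X ((volume.restrict (Ico (0 : ℝ) (2 * Real.pi))).withDensity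
        fun θ => ENNReal.ofReal (density ν β θ t)) P)
    (hm : AEMeasurable (fun θ => density ν β θ t) (volume.restrict (Ico (0 : ℝ) (2 * Real.pi))))
    (h0 : ∀ᵐ θ ∂(volume.restrict (Ico (0 : ℝ) (2 * Real.pi))), 0 ≤ density ν β θ t) :
    IntervalIntegrable (fun θ => density ν β θ t) volume 0 (2 * Real.pi) := by
  rw [intervalIntegrable_iff_integrableOn_Ico_of_le Real.two_pi_pos.le]
  refine ⟨hm.aestronglyMeasurable, ?_⟩
  rw [hasFiniteIntegral_iff_ofReal h0]
  have h := congrArg (fun μ : Measure ℝ => μ univ) hX.map_eq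
  have := Measure.isProbabilityMeasure_map (μ := P) hX.aemeasurable
  simp only [measure_univ, withDensity_apply _ MeasurableSet.univ, Measure.restrict_univ] at h
  rw [← h]
  exact ENNReal.one_lt_top

lemma pairing_density_eq {ν β t : ℝ} {X : Ω → ℝ}
    (hX : HasLaw X ((volume.restrict (Ico (0 : ℝ) (2 * Real.pi))).withDensity
        fun θ => ENNReal.ofReal (density ν β θ t)) P)
    (hm : AEMeasurable (fun θ => density ν β θ t) (volume.restrict (Ico (0 : ℝ) (2 * Real.pi))))
    (h0 : ∀ᵐ θ ∂(volume.restrict (Ico (0 : ℝ) (2 * Real.pi))), 0 ≤ density ν β θ t)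
    {f : ℝ → ℝ} (hf : Continuous f) :
    pairing (density ν β) f t = ∫ ω, f (X ω) ∂P := by
  rw [← integral_map (f := f) hX.aemeasurable hf.aestronglyMeasurable, hX.map_eq,
    integral_withDensity_eq_integral_toReal_smul₀ hm.ennreal_ofReal
      (ae_of_all _ fun _ => ENNReal.ofReal_lt_top), pairing,
    intervalIntegral.integral_of_le Real.two_pi_pos.le, ← integral_Ico_eq_integral_Ioc]
  refine integral_congr_ae (h0.mono fun θ hθ => ?_)
  simp only [ENNReal.toReal_ofReal hθ, smul_eq_mul, mul_comm]

lemma integral_tsum_cos [IsProbabilityMeasure P]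
    {X : Ω → ℝ} (hX : AEMeasurable X P) {r δ : ℤ → ℝ} {c : ℤ → ℝ}
    (hr : Summable fun k => |r k|)
    (hc : ∀ (k : ℤ) (δ : ℝ), ∫ ω, Real.cos (k * X ω + δ) ∂P = Real.cos δ * c k) :
    ∫ ω, ∑' k : ℤ, r k * Real.cos (k * X ω + δ k) ∂P = ∑' k, r k * Real.cos (δ k) * c k := by
  have hb : ∀ (k : ℤ) ω, ‖r k * Real.cos (k * X ω + δ k)‖ ≤ |r k| := fun k ω => by
    rw [norm_mul]
    exact mul_le_of_le_one_right (norm_nonneg _) (Real.abs_cos_le_one _)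
  have hint : ∀ k : ℤ, Integrable (fun ω => r k * Real.cos (k * X ω + δ k)) P := fun k =>
    Integrable.of_bound (AEMeasurable.aestronglyMeasurable (by fun_prop)) _ (ae_of_all _ (hb k))
  have h := hasSum_integral_of_summable_integral_norm hint (by
    refine Summable.of_nonneg_of_le (fun k => integral_nonneg fun _ => norm_nonneg _)
      (fun k => ?_) hr
    calc ∫ ω, ‖r k * Real.cos (k * X ω + δ k)‖ ∂P ≤ ∫ _, |r k| ∂P :=
          integral_mono (hint k).norm (integrable_const _) (hb k)
      _ = |r k| := by simp)
  rw [← h.tsum_eq]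
  refine tsum_congr fun k => ?_
  rw [integral_const_mul, hc, mul_assoc]

lemma continuous_tsum_cos {r δ : ℤ → ℝ} (hr : Summable fun k => |r k|) :
    Continuous fun θ => ∑' k : ℤ, r k * Real.cos (k * θ + δ k) :=
  continuous_tsum (fun k => by fun_prop) hr fun k θ => by
    rw [norm_mul]
    exact mul_le_of_le_one_right (norm_nonneg _) (Real.abs_cos_le_one _)

end Pairing

/-! ### Series of Mittag-Leffler functions and the Caputo equation -/

/-- The derivative of `s ↦ E_ν(-l s^ν)` is dominated by `l s^(ν-1)`. -/
lemma abs_deriv_mittagLeffler_rpow_le {ν : ℝ} (hν : 0 < ν) (hE : MittagLefflerBounds ν) {l s : ℝ}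
    (hl : 0 ≤ l) (hs : 0 < s) :
    |deriv (fun s => mittagLeffler ν (-(l * s ^ ν))) s| ≤
      1 / Real.Gamma (ν + 1) * ν * l * s ^ (ν - 1) := by
  have hC : 0 < Real.Gamma (ν + 1) := Real.Gamma_pos_of_pos (by linarith)
  have h1 : HasDerivAt (fun s : ℝ => l * s ^ ν) (l * (ν * s ^ (ν - 1))) s :=
    (Real.hasDerivAt_rpow_const (Or.inl hs.ne')).const_mul l
  rcases hl.eq_or_lt with rfl | hl
  · simp
  set G : ℝ → ℝ := fun x => mittagLeffler ν (-x)
  have hx : 0 < l * s ^ ν := by positivity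
  have hG : HasDerivAt G (deriv G (l * s ^ ν)) (l * s ^ ν) :=
    ((hasDerivAt_mittagLeffler hν _).comp _ (hasDerivAt_neg _)).differentiableAt.hasDerivAt
  -- A derivative is bounded by a local Lipschitz constant. The Lipschitz bound is available only on
  -- the half-line, so `l s^ν` must be interior, which is why `l = 0` was split off.
  have hGle : ‖deriv G (l * s ^ ν)‖ ≤ 1 / Real.Gamma (ν + 1) := by
    refine hG.le_of_lip' (by positivity) ?_
    filter_upwards [lt_mem_nhds hx] with y hy
    exact hE.abs_sub_le _ _ hy.le hx.le
  have h2 : HasDerivAt (fun s => mittagLeffler ν (-(l * s ^ ν)))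
      (deriv G (l * s ^ ν) * (l * (ν * s ^ (ν - 1)))) s :=
    HasDerivAt.comp (h₂ := G) s hG h1
  rw [h2.deriv, abs_mul, abs_of_nonneg (by positivity : 0 ≤ l * (ν * s ^ (ν - 1)))]
  calc |deriv G (l * s ^ ν)| * (l * (ν * s ^ (ν - 1)))
      ≤ 1 / Real.Gamma (ν + 1) * (l * (ν * s ^ (ν - 1))) := by gcongr; exact hGle
    _ = _ := by ring

section Series

variable {ι : Type*} {ν : ℝ} {b l : ι → ℝ}

lemma summable_mul_mittagLeffler (hE : MittagLefflerBounds ν) (hl : ∀ k, 0 ≤ l k)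
    (hb : Summable fun k => |b k|) {s : ℝ} (hs : 0 < s) :
    Summable fun k => b k * mittagLeffler ν (-(l k * s ^ ν)) := by
  refine Summable.of_norm_bounded hb fun k => ?_
  have h0 : 0 ≤ l k * s ^ ν := mul_nonneg (hl k) (by positivity)
  rw [norm_mul, Real.norm_of_nonneg (hE.nonneg _)]
  exact mul_le_of_le_one_right (norm_nonneg _) (hE.le_one _ h0)

lemma norm_mul_deriv_mittagLeffler_le (hν : 0 < ν) (hE : MittagLefflerBounds ν)
    (hl : ∀ k, 0 ≤ l k) (k : ι) {s : ℝ} (hs : 0 < s) :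
    ‖b k * deriv (fun s => mittagLeffler ν (-(l k * s ^ ν))) s‖ ≤
      |b k| * l k * (1 / Real.Gamma (ν + 1) * ν * s ^ (ν - 1)) := by
  rw [norm_mul, Real.norm_eq_abs]
  calc |b k| * _ ≤ |b k| * (1 / Real.Gamma (ν + 1) * ν * l k * s ^ (ν - 1)) := by
        gcongr
        exact abs_deriv_mittagLeffler_rpow_le hν hE (hl k) hs
    _ = _ := by ring

/-- Termwise differentiation of a series of Mittag-Leffler functions. -/
lemma hasDerivAt_tsum_mittagLeffler (hν : ν ∈ Ioc (0 : ℝ) 1) (hE : MittagLefflerBounds ν)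
    (hl : ∀ k, 0 ≤ l k) (hb : Summable fun k => |b k|) (hbl : Summable fun k => |b k| * l k)
    {s : ℝ} (hs : 0 < s) :
    HasDerivAt (fun s => ∑' k, b k * mittagLeffler ν (-(l k * s ^ ν)))
      (∑' k, b k * deriv (fun s => mittagLeffler ν (-(l k * s ^ ν))) s) s := by
  have hC : 0 < Real.Gamma (ν + 1) := Real.Gamma_pos_of_pos (by linarith [hν.1])
  -- On `(s/2, ∞)` the factor `y^(ν-1)` is at most `(s/2)^(ν-1)`, since `ν ≤ 1`; this makes the
  -- majorant uniform.
  have hs2 : 0 < s / 2 := by linarith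
  have hmem : s ∈ Ioi (s / 2) := by simp only [mem_Ioi]; linarith
  refine hasDerivAt_tsum_of_isPreconnected (𝕜 := ℝ)
    (g := fun k s => b k * mittagLeffler ν (-(l k * s ^ ν)))
    (g' := fun k s => b k * deriv (fun s => mittagLeffler ν (-(l k * s ^ ν))) s)
    (hbl.mul_right (1 / Real.Gamma (ν + 1) * ν * (s / 2) ^ (ν - 1))) isOpen_Ioi
    (convex_Ioi (s / 2)).isPreconnected (fun k y hy => ?_) (fun k y hy => ?_) hmem
    (summable_mul_mittagLeffler hE hl hb hs) hmem
  · have hy0 : 0 < y := hs2.trans hy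
    exact ((hasDerivAt_mittagLeffler_rpow hν.1 (l k) hy0).differentiableAt.hasDerivAt).const_mul _
  · have hy0 : 0 < y := hs2.trans hy
    refine (norm_mul_deriv_mittagLeffler_le hν.1 hE hl k hy0).trans ?_
    have h1 : y ^ (ν - 1) ≤ (s / 2) ^ (ν - 1) :=
      Real.rpow_le_rpow_of_nonpos hs2 (le_of_lt hy) (by linarith [hν.2])
    have := hl k
    have := hν.1.le
    gcongr

/-- Series of Mittag-Leffler functions solve the corresponding fractional equation. -/
lemma hasCaputoDeriv_tsum_mittagLeffler [Countable ι]
    (hν : ν ∈ Ioc (0 : ℝ) 1) (hE : MittagLefflerBounds ν)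
    (hl : ∀ k, 0 ≤ l k) (hb : Summable fun k => |b k|) (hbl : Summable fun k => |b k| * l k)
    {u : ℝ → ℝ} (hu : ∀ s, 0 < s → u s = ∑' k, b k * mittagLeffler ν (-(l k * s ^ ν)))
    {t : ℝ} (ht : 0 < t) :
    HasCaputoDeriv ν u t (-∑' k, b k * l k * mittagLeffler ν (-(l k * t ^ ν))) := by
  have hud : ∀ s, 0 < s → HasDerivAt u
      (∑' k, b k * deriv (fun s => mittagLeffler ν (-(l k * s ^ ν))) s) s := fun s hs =>
    (hasDerivAt_tsum_mittagLeffler hν hE hl hb hbl hs).congr_of_eventuallyEq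
      ((eventually_gt_nhds hs).mono fun y hy => hu y hy)
  have hC : 0 < Real.Gamma (ν + 1) := Real.Gamma_pos_of_pos (by linarith [hν.1])
  rw [HasCaputoDeriv]
  split_ifs with h1
  · subst h1
    refine (hud t ht).congr_deriv ?_
    rw [← tsum_neg]
    refine tsum_congr fun k => ?_
    simp_rw [mittagLeffler_one, Real.rpow_one]
    have h2 : HasDerivAt (fun s => Real.exp (-(l k * s))) (Real.exp (-(l k * t)) * -(l k * 1)) t :=
      ((hasDerivAt_id t).const_mul (l k)).neg.exp
    rw [h2.deriv]
    ring
  have hν1 : ν < 1 := lt_of_le_of_ne hν.2 h1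
  have hG : 0 < Real.Gamma (1 - ν) := Real.Gamma_pos_of_pos (by linarith)
  -- The Beta integrand with parameters `ν` and `1 - ν`. A constant times `|b_k| l_k w` dominates
  -- each term, which gives both the absolute convergence of the Caputo integral and the exchange
  -- with the sum.
  set w : ℝ → ℝ := fun s => s ^ (ν - 1) * (t - s) ^ ((1 - ν) - 1) with hw
  have hwint : IntegrableOn w (Ioc 0 t) :=
    (intervalIntegrable_iff_integrableOn_Ioc_of_le ht.le).1
      (intervalIntegrable_rpow_mul_sub_rpow hν.1 (by linarith) ht)
  set F : ι → ℝ → ℝ := fun k s =>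
    b k * deriv (fun s => mittagLeffler ν (-(l k * s ^ ν))) s / (t - s) ^ ν with hF
  have hFle : ∀ k, ∀ s ∈ Ioc 0 t, ‖F k s‖ ≤ |b k| * l k * (1 / Real.Gamma (ν + 1) * ν * w s) := by
    intro k s hs
    have h3 : 0 ≤ t - s := by linarith [hs.2]
    have h4 := norm_mul_deriv_mittagLeffler_le (b := b) hν.1 hE hl k hs.1
    simp only [hF, hw]
    rw [norm_div, Real.norm_of_nonneg (Real.rpow_nonneg h3 ν), sub_sub_cancel_left,
      Real.rpow_neg h3, div_eq_mul_inv]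
    calc _ ≤ |b k| * l k * (1 / Real.Gamma (ν + 1) * ν * s ^ (ν - 1)) * ((t - s) ^ ν)⁻¹ := by
          gcongr
      _ = _ := by ring
  have hFm : ∀ k, Measurable (F k) := fun k => by
    have := measurable_deriv (fun s => mittagLeffler ν (-(l k * s ^ ν)))
    fun_prop
  have hFint : ∀ k, IntegrableOn (F k) (Ioc 0 t) := fun k =>
    ((hwint.const_mul (1 / Real.Gamma (ν + 1) * ν)).const_mul (|b k| * l k)).mono'
      (hFm k).aestronglyMeasurable
      ((ae_restrict_iff' measurableSet_Ioc).2 (ae_of_all _ (hFle k)))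
  have hsum := hasSum_integral_of_summable_integral_norm hFint (by
    refine Summable.of_nonneg_of_le (fun k => integral_nonneg fun _ => norm_nonneg _)
      (fun k => ?_) (hbl.mul_right (∫ s in Ioc 0 t, 1 / Real.Gamma (ν + 1) * ν * w s))
    rw [← integral_const_mul]
    exact setIntegral_mono_on (hFint k).norm
      ((hwint.const_mul (1 / Real.Gamma (ν + 1) * ν)).const_mul (|b k| * l k))
      measurableSet_Ioc (hFle k))
  have hderiv : ∀ s ∈ Ioc 0 t, deriv u s / (t - s) ^ ν = ∑' k, F k s := fun s hs => by
    rw [(hud s hs.1).deriv, ← tsum_div_const]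
  refine ⟨fun s hs => (hud s hs.1).differentiableAt, ?_, ?_⟩
  · rw [intervalIntegrable_iff_integrableOn_Ioc_of_le ht.le]
    refine (hwint.const_mul ((∑' k, |b k| * l k) * (1 / Real.Gamma (ν + 1) * ν))).mono' ?_
      ((ae_restrict_iff' measurableSet_Ioc).2 (ae_of_all _ fun s hs => ?_))
    · have := measurable_deriv u
      exact Measurable.aestronglyMeasurable (by fun_prop)
    · rw [hderiv s hs, mul_assoc, ← tsum_mul_right]
      exact tsum_of_norm_bounded ((hbl.mul_right _).hasSum) fun k => hFle k s hs
  · rw [intervalIntegral.integral_of_le ht.le,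
      setIntegral_congr_fun measurableSet_Ioc hderiv, ← hsum.tsum_eq, ← tsum_mul_left, ← tsum_neg]
    refine tsum_congr fun k => ?_
    have h5 := integral_deriv_mittagLeffler hν.1 hν1 (l := l k) ht
    rw [intervalIntegral.integral_of_le ht.le] at h5
    simp only [hF, mul_div_assoc]
    rw [integral_const_mul, h5]
    field_simp

lemma tendsto_tsum_mittagLeffler (hν : 0 < ν) (hE : MittagLefflerBounds ν) (hl : ∀ k, 0 ≤ l k)
    (hb : Summable fun k => |b k|) :
    Tendsto (fun t => ∑' k, b k * mittagLeffler ν (-(l k * t ^ ν))) (𝓝[>] 0) (𝓝 (∑' k, b k)) := by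
  refine tendsto_tsum_of_dominated_convergence hb (fun k => ?_) ?_
  · have h1 : Tendsto (fun t : ℝ => -(l k * t ^ ν)) (𝓝[>] 0) (𝓝 (-(l k * 0 ^ ν))) :=
      (((Real.continuousAt_rpow_const 0 ν (Or.inr hν.le)).tendsto.const_mul _).neg).mono_left
        nhdsWithin_le_nhds
    rw [Real.zero_rpow hν.ne', mul_zero, neg_zero] at h1
    have h2 := ((continuous_mittagLeffler hν).tendsto 0).comp h1
    rw [mittagLeffler_zero] at h2
    simpa using h2.const_mul (b k)
  · filter_upwards [self_mem_nhdsWithin] with t ht k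
    have h0 : 0 ≤ l k * t ^ ν := mul_nonneg (hl k) (Real.rpow_nonneg (le_of_lt ht) ν)
    rw [norm_mul, Real.norm_of_nonneg (hE.nonneg _)]
    exact mul_le_of_le_one_right (norm_nonneg _) (hE.le_one _ h0)

end Series

/-! ### Fourier expansion of smooth test functions -/

section FourierSeries

lemma deriv_periodic {f : ℝ → ℂ} {T : ℝ} (hf : Function.Periodic f T) :
    Function.Periodic (deriv f) T := fun x => by
  rw [← deriv_comp_add_const, show (fun y => f (y + T)) = f from funext hf]

lemma exp_neg_int_mul_two_pi (n : ℤ) :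
    Complex.exp (-(n * Complex.I) * ((2 * Real.pi : ℝ) : ℂ)) = 1 := by
  rw [Complex.exp_eq_one_iff]
  exact ⟨-n, by push_cast; ring⟩

/-- Integration by parts; the boundary terms cancel by periodicity. -/
lemma integral_exp_mul_deriv {f : ℝ → ℂ} (hf : ContDiff ℝ (⊤ : ℕ∞) f)
    (hp : Function.Periodic f (2 * Real.pi)) (n : ℤ) :
    ∫ x in (0 : ℝ)..2 * Real.pi, Complex.exp (-(n * Complex.I) * x) * deriv f x =
      n * Complex.I * ∫ x in (0 : ℝ)..2 * Real.pi, Complex.exp (-(n * Complex.I) * x) * f x := by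
  have hdf : Differentiable ℝ f := hf.differentiable (by simp)
  have hu : ∀ x : ℝ, HasDerivAt (fun x : ℝ => Complex.exp (-(n * Complex.I) * x))
      (Complex.exp (-(n * Complex.I) * x) * (-(n * Complex.I) * 1)) x := fun x =>
    ((Complex.ofRealCLM.hasDerivAt (x := x)).const_mul _).cexp
  rw [intervalIntegral.integral_mul_deriv_eq_deriv_mul (fun x _ => hu x)
    (fun x _ => (hdf x).hasDerivAt)
    (Continuous.intervalIntegrable (by fun_prop) _ _)
    ((hf.continuous_deriv (by simp)).intervalIntegrable _ _),
    exp_neg_int_mul_two_pi, ← intervalIntegral.integral_const_mul]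
  have h0 : f (2 * Real.pi) = f 0 := by simpa using hp 0
  rw [h0]
  simp only [Complex.ofReal_zero, mul_zero, Complex.exp_zero, sub_self, zero_sub,
    ← intervalIntegral.integral_neg]
  congr 1
  ext x
  ring

/-- Fourier coefficients of smooth functions decay rapidly. -/
lemma exists_norm_integral_exp_mul_le {f : ℝ → ℂ} (hf : ContDiff ℝ (⊤ : ℕ∞) f)
    (hp : Function.Periodic f (2 * Real.pi)) (m : ℕ) :
    ∃ C, ∀ n : ℤ, |(n : ℝ)| ^ m *
      ‖∫ x in (0 : ℝ)..2 * Real.pi, Complex.exp (-(n * Complex.I) * x) * f x‖ ≤ C := by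
  induction m generalizing f with
  | zero =>
    refine ⟨∫ x in (0 : ℝ)..2 * Real.pi, ‖f x‖, fun n => ?_⟩
    rw [pow_zero, one_mul]
    refine (intervalIntegral.norm_integral_le_integral_norm Real.two_pi_pos.le).trans_eq ?_
    congr 1
    ext x
    have e : -(n * Complex.I) * (x : ℂ) = ((-(n * x) : ℝ) : ℂ) * Complex.I := by push_cast; ring
    rw [norm_mul, e, Complex.norm_exp_ofReal_mul_I, one_mul]
  | succ m ih =>
    have hf' : ContDiff ℝ (⊤ : ℕ∞) (deriv f) := (contDiff_infty_iff_deriv.1 hf).2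
    obtain ⟨C, hC⟩ := ih hf' (deriv_periodic hp)
    refine ⟨C, fun n => ?_⟩
    have h := hC n
    rw [integral_exp_mul_deriv hf hp, norm_mul, norm_mul, Complex.norm_I, mul_one,
      Complex.norm_intCast, ← mul_assoc, ← pow_succ] at h
    exact h

/-- Fourier series of a smooth periodic function, in amplitude-phase form. -/
lemma exists_tsum_cos {φ : ℝ → ℝ} (hφ : ContDiff ℝ (⊤ : ℕ∞) φ)
    (hp : Function.Periodic φ (2 * Real.pi)) :
    ∃ r δ : ℤ → ℝ, (∀ k, 0 ≤ r k) ∧ Summable r ∧ (Summable fun k => r k * (k : ℝ) ^ 2) ∧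
      ∀ θ, φ θ = ∑' k : ℤ, r k * Real.cos (k * θ + δ k) := by
  have : Fact (0 < 2 * Real.pi) := ⟨Real.two_pi_pos⟩
  have hpi := Real.pi_pos
  set f : ℝ → ℂ := fun x => (φ x : ℂ)
  have hf : ContDiff ℝ (⊤ : ℕ∞) f := Complex.ofRealCLM.contDiff.comp hφ
  have hfp : Function.Periodic f (2 * Real.pi) := fun x => by simp only [f, hp x]
  set F : C(AddCircle (2 * Real.pi), ℂ) :=
    ⟨hfp.lift, continuous_coinduced_dom.mpr hf.continuous⟩
  have hF : ∀ x : ℝ, F (x : AddCircle (2 * Real.pi)) = f x := fun x => hfp.lift_coe x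
  have hcoef : ∀ n : ℤ, fourierCoeff F n = (1 / (2 * Real.pi) : ℝ) •
      ∫ x in (0 : ℝ)..2 * Real.pi, Complex.exp (-(n * Complex.I) * x) * f x := by
    intro n
    rw [fourierCoeff_eq_intervalIntegral F n 0, zero_add]
    congr 2
    ext x
    rw [hF, fourier_coe_apply, smul_eq_mul]
    congr 2
    have hpi' : (Real.pi : ℂ) ≠ 0 := by exact_mod_cast hpi.ne'
    push_cast
    field_simp
  -- Fourth-order decay makes `r_k k²` of order `1/k²`, as the summability of `r_k k²` demands.
  obtain ⟨C, hC⟩ := exists_norm_integral_exp_mul_le hf hfp 4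
  set r : ℤ → ℝ := fun k => ‖fourierCoeff F k‖
  have hr0 : ∀ k, 0 ≤ r k := fun k => norm_nonneg _
  have hr4 : ∀ k : ℤ, (k : ℝ) ^ 2 * (r k * (k : ℝ) ^ 2) ≤ 1 / (2 * Real.pi) * C := by
    intro k
    have h := hC k
    have e : r k = 1 / (2 * Real.pi) *
        ‖∫ x in (0 : ℝ)..2 * Real.pi, Complex.exp (-(k * Complex.I) * x) * f x‖ := by
      simp only [r, hcoef k, norm_smul]
      rw [Real.norm_of_nonneg (by positivity)]
    rw [Even.pow_abs (by decide)] at h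
    calc (k : ℝ) ^ 2 * (r k * (k : ℝ) ^ 2) = 1 / (2 * Real.pi) * ((k : ℝ) ^ 4 *
          ‖∫ x in (0 : ℝ)..2 * Real.pi, Complex.exp (-(k * Complex.I) * x) * f x‖) := by
          rw [e]; ring
      _ ≤ _ := by gcongr
  have hs2 : Summable fun k => r k * (k : ℝ) ^ 2 := by
    refine Summable.of_nonneg_of_le (fun k => by have := hr0 k; positivity) (fun k => ?_)
      ((Real.summable_one_div_int_pow.2 one_lt_two).mul_left (1 / (2 * Real.pi) * C))
    rcases eq_or_ne k 0 with rfl | hk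
    · simp
    · have hk' : (0 : ℝ) < (k : ℝ) ^ 2 := by positivity
      rw [mul_one_div, le_div_iff₀ hk', mul_comm]
      exact hr4 k
  have hs : Summable r := by
    refine Summable.of_nonneg_of_le hr0 (fun k => ?_)
      (hs2.add (hasSum_ite_eq (0 : ℤ) (r 0)).summable)
    rcases eq_or_ne k 0 with rfl | hk
    · simp
    · rw [if_neg hk, add_zero]
      refine le_mul_of_one_le_right (hr0 k) ?_
      have : (1 : ℤ) ≤ k ^ 2 := by have : 0 < k ^ 2 := by positivity
                                   omega
      exact_mod_cast this
  -- Modulus and argument of each coefficient give amplitude and phase: as `φ` is real, the real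
  -- part of its complex Fourier series is the cosine series.
  refine ⟨r, fun k => Complex.arg (fourierCoeff F k), hr0, hs, hs2, fun θ => ?_⟩
  have h := has_pointwise_sum_fourier_series_of_summable (f := F) (Summable.of_norm hs)
    (θ : AddCircle (2 * Real.pi))
  rw [hF] at h
  have hre := Complex.hasSum_re h
  simp only [f, Complex.ofReal_re] at hre
  rw [← hre.tsum_eq]
  refine tsum_congr fun k => ?_
  have e : fourierCoeff F k • fourier k (θ : AddCircle (2 * Real.pi)) =
      (r k : ℂ) * Complex.exp (((k * θ + Complex.arg (fourierCoeff F k) : ℝ) : ℂ) * Complex.I) := by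
    rw [fourier_coe_apply, smul_eq_mul]
    conv_lhs => rw [← Complex.norm_mul_exp_arg_mul_I (fourierCoeff F k)]
    rw [mul_assoc, ← Complex.exp_add]
    congr 2
    have hpi' : (Real.pi : ℂ) ≠ 0 := by exact_mod_cast hpi.ne'
    push_cast
    field_simp
    ring
  rw [e, Complex.re_ofReal_mul, Complex.exp_ofReal_mul_I_re]

/-- The operator `-(1/2) ∂²/∂θ²` acts termwise. -/
lemma halfNegLaplacian_tsum_cos {r δ : ℤ → ℝ} (hr : ∀ k, 0 ≤ r k) (hs : Summable r)
    (hs2 : Summable fun k => r k * (k : ℝ) ^ 2) {φ : ℝ → ℝ}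
    (hφ : ∀ θ, φ θ = ∑' k : ℤ, r k * Real.cos (k * θ + δ k)) (θ : ℝ) :
    halfNegLaplacian φ θ = ∑' k : ℤ, (r k * ((k : ℝ) ^ 2 / 2)) * Real.cos (k * θ + δ k) := by
  have hs1 : Summable fun k : ℤ => r k * |(k : ℝ)| := by
    refine Summable.of_nonneg_of_le (fun k => mul_nonneg (hr k) (abs_nonneg _)) (fun k => ?_)
      (hs.add hs2)
    rw [← mul_one_add]
    refine mul_le_mul_of_nonneg_left ?_ (hr k)
    rw [← sq_abs]
    nlinarith [sq_nonneg (|(k : ℝ)| - 1)]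
  have hlin : ∀ (k : ℤ) (x : ℝ), HasDerivAt (fun x : ℝ => k * x + δ k) (k : ℝ) x := fun k x => by
    simpa using ((hasDerivAt_id x).const_mul (k : ℝ)).add_const (δ k)
  have h1 : ∀ x, HasDerivAt φ (∑' k : ℤ, r k * (-Real.sin (k * x + δ k) * k)) x := by
    intro x
    rw [funext hφ]
    refine hasDerivAt_tsum (y₀ := 0) hs1 (fun k y => ((hlin k y).cos).const_mul (r k))
      (fun k y => ?_) ?_ x
    · rw [norm_mul, norm_mul, norm_neg, Real.norm_of_nonneg (hr k)]
      refine mul_le_mul_of_nonneg_left ?_ (hr k)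
      exact mul_le_of_le_one_left (norm_nonneg _) (Real.abs_sin_le_one _)
    · refine Summable.of_norm_bounded hs fun k => ?_
      rw [norm_mul, Real.norm_of_nonneg (hr k)]
      exact mul_le_of_le_one_right (hr k) (Real.abs_cos_le_one _)
  have h2 : HasDerivAt (fun x => ∑' k : ℤ, r k * (-Real.sin (k * x + δ k) * k))
      (∑' k : ℤ, r k * (-(Real.cos (k * θ + δ k) * k) * k)) θ := by
    refine hasDerivAt_tsum (y₀ := 0) hs2
      (fun k y => (((hlin k y).sin).neg.mul_const (k : ℝ)).const_mul (r k)) (fun k y => ?_) ?_ θ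
    · rw [norm_mul, norm_mul, norm_neg, norm_mul, Real.norm_of_nonneg (hr k), mul_assoc,
        Real.norm_eq_abs (k : ℝ), abs_mul_abs_self, ← sq]
      refine mul_le_mul_of_nonneg_left ?_ (hr k)
      exact mul_le_of_le_one_left (by positivity) (Real.abs_cos_le_one _)
    · refine Summable.of_norm_bounded hs1 fun k => ?_
      rw [norm_mul, norm_mul, Pi.neg_apply, norm_neg, Real.norm_of_nonneg (hr k)]
      refine mul_le_mul_of_nonneg_left ?_ (hr k)
      exact mul_le_of_le_one_left (norm_nonneg _) (Real.abs_sin_le_one _)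
  rw [halfNegLaplacian, iteratedDeriv_succ, iteratedDeriv_one,
    show deriv φ = _ from funext fun x => (h1 x).deriv, h2.deriv, ← tsum_mul_left]
  refine tsum_congr fun k => ?_
  ring

end FourierSeries

lemma summable_mul_rpow {β : ℝ} (hβ : β ∈ Ioc (0 : ℝ) 1) {r : ℤ → ℝ} (hr : ∀ k, 0 ≤ r k)
    (hs : Summable r) (hs2 : Summable fun k => r k * (k : ℝ) ^ 2) :
    Summable fun k : ℤ => r k * ((k : ℝ) ^ 2 / 2) ^ β := by
  refine Summable.of_nonneg_of_le (fun k => mul_nonneg (hr k) (by positivity)) (fun k => ?_)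
    (hs.add hs2)
  rw [← mul_one_add]
  refine mul_le_mul_of_nonneg_left ?_ (hr k)
  have h0 : 0 ≤ (k : ℝ) ^ 2 / 2 := by positivity
  calc ((k : ℝ) ^ 2 / 2) ^ β ≤ (1 + (k : ℝ) ^ 2 / 2) ^ β := by
        have := hβ.1.le
        gcongr; linarith
    _ ≤ (1 + (k : ℝ) ^ 2 / 2) ^ (1 : ℝ) :=
        Real.rpow_le_rpow_of_exponent_le (by linarith) hβ.2
    _ ≤ 1 + (k : ℝ) ^ 2 := by rw [Real.rpow_one]; linarith

/-! ### Resolvent and fractional power on Fourier modes -/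

section Resolvent

lemma exp_neg_mul_abs_mul_exp_eq {c : ℝ} (k z : ℝ) :
    ((Real.exp (-(c * |z|)) : ℝ) : ℂ) * Complex.exp ((k * z : ℝ) * Complex.I) =
      if 0 < z then Complex.exp ((-c + k * Complex.I) * z)
      else Complex.exp ((c + k * Complex.I) * z) := by
  rw [Complex.ofReal_exp, ← Complex.exp_add]
  split_ifs with h
  · rw [abs_of_pos h]; congr 1; push_cast; ring
  · rw [abs_of_nonpos (not_lt.1 h)]; congr 1; push_cast; ring

lemma integrable_exp_neg_mul_abs_mul_exp {c : ℝ} (hc : 0 < c) (k : ℝ) :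
    Integrable fun z : ℝ =>
      ((Real.exp (-(c * |z|)) : ℝ) : ℂ) * Complex.exp ((k * z : ℝ) * Complex.I) := by
  rw [← integrableOn_univ, ← Iic_union_Ioi (a := (0 : ℝ))]
  refine IntegrableOn.union ?_ ?_
  · refine (integrableOn_exp_mul_complex_Iic (a := c + k * Complex.I) (by simpa) 0).congr_fun
      (fun z hz => ?_) measurableSet_Iic
    simp only
    rw [exp_neg_mul_abs_mul_exp_eq, if_neg (not_lt.2 hz.out)]
  · refine (integrableOn_exp_mul_complex_Ioi (a := -c + k * Complex.I) (by simpa) 0).congr_fun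
      (fun z hz => ?_) measurableSet_Ioi
    simp only
    rw [exp_neg_mul_abs_mul_exp_eq, if_pos hz.out]

lemma integral_exp_neg_mul_abs_mul_exp {c : ℝ} (hc : 0 < c) (k : ℝ) :
    ∫ z : ℝ, ((Real.exp (-(c * |z|)) : ℝ) : ℂ) * Complex.exp ((k * z : ℝ) * Complex.I) =
      ((2 * c / (c ^ 2 + k ^ 2) : ℝ) : ℂ) := by
  have hint := integrable_exp_neg_mul_abs_mul_exp hc k
  rw [← intervalIntegral.integral_Iic_add_Ioi (b := 0) hint.integrableOn hint.integrableOn]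
  have h1 : ∫ z in Iic (0 : ℝ), ((Real.exp (-(c * |z|)) : ℝ) : ℂ) *
      Complex.exp ((k * z : ℝ) * Complex.I) =
      ∫ z in Iic (0 : ℝ), Complex.exp ((c + k * Complex.I) * z) :=
    setIntegral_congr_fun measurableSet_Iic fun z hz => by
      rw [exp_neg_mul_abs_mul_exp_eq, if_neg (not_lt.2 hz.out)]
  have h2 : ∫ z in Ioi (0 : ℝ), ((Real.exp (-(c * |z|)) : ℝ) : ℂ) *
      Complex.exp ((k * z : ℝ) * Complex.I) =
      ∫ z in Ioi (0 : ℝ), Complex.exp ((-c + k * Complex.I) * z) :=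
    setIntegral_congr_fun measurableSet_Ioi fun z hz => by
      rw [exp_neg_mul_abs_mul_exp_eq, if_pos hz.out]
  rw [h1, h2, integral_exp_mul_complex_Iic (by simpa), integral_exp_mul_complex_Ioi (by simpa)]
  have e1 : (c : ℂ) + k * Complex.I ≠ 0 := fun h => by
    have := congrArg Complex.re h; simp at this; exact hc.ne' this
  have e2 : -(c : ℂ) + k * Complex.I ≠ 0 := fun h => by
    have := congrArg Complex.re h; simp at this; exact hc.ne' this
  have e3 : (c : ℂ) ^ 2 + k ^ 2 ≠ 0 := by
    have : c ^ 2 + k ^ 2 ≠ 0 := by positivity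
    exact_mod_cast this
  push_cast
  simp only [mul_zero, Complex.exp_zero]
  have hI : Complex.I ^ 2 = -1 := Complex.I_sq
  field_simp
  linear_combination (-2 * c * (k : ℂ) ^ 2) * hI

lemma integrable_exp_neg_mul_abs_sub {c : ℝ} (hc : 0 < c) (θ : ℝ) :
    Integrable fun y : ℝ => Real.exp (-(c * |θ - y|)) := by
  have h := (integrable_exp_neg_mul_abs_mul_exp hc 0).norm
  refine (h.comp_sub_left θ).congr (ae_of_all _ fun y => ?_)
  beta_reduce
  rw [norm_mul, Complex.norm_exp_ofReal_mul_I, mul_one, Complex.norm_real,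
    Real.norm_of_nonneg (Real.exp_pos _).le]

/-- Convolution with `exp (-c|·|)` multiplies frequency `k` by the Fourier transform of the kernel.
With `c = √(2μ)` and the prefactor `1/c`, the multiplier is `1/(μ + k²/2)`. -/
lemma integral_exp_neg_mul_abs_mul_cos {c : ℝ} (hc : 0 < c) (k δ θ : ℝ) :
    ∫ y, Real.exp (-(c * |θ - y|)) * Real.cos (k * y + δ) =
      2 * c / (c ^ 2 + k ^ 2) * Real.cos (k * θ + δ) := by
  rw [← integral_add_right_eq_self (fun y => Real.exp (-(c * |θ - y|)) * Real.cos (k * y + δ)) θ]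
  have hint := (integrable_exp_neg_mul_abs_mul_exp hc k).const_mul
    (Complex.exp ((k * θ + δ : ℝ) * Complex.I))
  have h := integral_re (𝕜 := ℂ) hint
  simp only [RCLike.re_eq_complex_re] at h
  rw [integral_const_mul, integral_exp_neg_mul_abs_mul_exp hc, mul_comm (Complex.exp _),
    Complex.re_ofReal_mul, Complex.exp_ofReal_mul_I_re] at h
  rw [← h]
  refine integral_congr_ae (ae_of_all _ fun z => ?_)
  simp only
  rw [mul_left_comm, Complex.re_ofReal_mul, ← Complex.exp_add, ← add_mul, ← Complex.ofReal_add,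
    Complex.exp_ofReal_mul_I_re]
  have e : |θ - (z + θ)| = |z| := by rw [← abs_neg]; congr 1; ring
  rw [e]
  congr 2
  ring

/-- The resolvent acts termwise on trigonometric series. -/
lemma greenResolvent_tsum_cos {ρ δ : ℤ → ℝ} (hρ : Summable fun k => |ρ k|) {f : ℝ → ℝ}
    (hf : ∀ θ, f θ = ∑' k : ℤ, ρ k * Real.cos (k * θ + δ k)) {μ : ℝ} (hμ : 0 < μ) (θ : ℝ) :
    greenResolvent μ f θ = ∑' k : ℤ, ρ k * Real.cos (k * θ + δ k) / (μ + (k : ℝ) ^ 2 / 2) := by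
  set c := √(2 * μ)
  have hc : 0 < c := Real.sqrt_pos.2 (by linarith)
  have hc2 : c ^ 2 = 2 * μ := Real.sq_sqrt (by linarith)
  set F : ℤ → ℝ → ℝ := fun k y =>
    ρ k * (Real.exp (-(c * |θ - y|)) * Real.cos (k * y + δ k)) with hF
  have hE := integrable_exp_neg_mul_abs_sub hc θ
  have hle : ∀ k y, ‖F k y‖ ≤ |ρ k| * Real.exp (-(c * |θ - y|)) := by
    intro k y
    simp only [hF]
    rw [norm_mul, norm_mul, Real.norm_of_nonneg (Real.exp_pos _).le]
    refine mul_le_mul_of_nonneg_left ?_ (abs_nonneg _)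
    exact mul_le_of_le_one_right (Real.exp_pos _).le (Real.abs_cos_le_one _)
  have hint : ∀ k, Integrable (F k) := fun k =>
    (hE.const_mul |ρ k|).mono' (by simp only [hF]; fun_prop) (ae_of_all _ (hle k))
  have hsum := hasSum_integral_of_summable_integral_norm hint (by
    refine Summable.of_nonneg_of_le (fun k => integral_nonneg fun _ => norm_nonneg _)
      (fun k => ?_) (hρ.mul_right (∫ y, Real.exp (-(c * |θ - y|))))
    rw [← integral_const_mul]
    exact integral_mono (hint k).norm (hE.const_mul _) (hle k))
  have h1 : ∀ y, Real.exp (-(c * |θ - y|)) * f y = ∑' k, F k y := fun y => by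
    rw [hf, ← tsum_mul_left]
    exact tsum_congr fun k => by simp only [hF]; ring
  rw [greenResolvent]
  change 1 / c * ∫ y, Real.exp (-(c * |θ - y|)) * f y = _
  simp_rw [h1]
  rw [← hsum.tsum_eq, ← tsum_mul_left]
  refine tsum_congr fun k => ?_
  simp only [hF]
  rw [integral_const_mul, integral_exp_neg_mul_abs_mul_cos hc, hc2]
  have : 0 < μ + (k : ℝ) ^ 2 / 2 := by positivity
  have h2 : (2 * μ + (k : ℝ) ^ 2) ≠ 0 := by positivity
  field_simp

/-- `1/(μ + a)` is the Laplace transform at `μ` of the measure `exp (-ax) dx` on the half-line.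
Hence `lintegral_rpow_neg`, for the identity variable under this measure, reduces the integral to
`Γ(β) ∫ x^(-β) exp (-ax) dx`. -/
lemma lintegral_rpow_div_add {β a : ℝ} (hβ : 0 < β) (hβ1 : β < 1) (ha : 0 < a) :
    ∫⁻ μ in Ioi (0 : ℝ), ENNReal.ofReal (μ ^ (β - 1) / (μ + a)) =
      ENNReal.ofReal (Real.Gamma β * Real.Gamma (1 - β) * a ^ (β - 1)) := by
  have hG := Real.Gamma_pos_of_pos hβ
  have hG1 : 0 < Real.Gamma (1 - β) := Real.Gamma_pos_of_pos (by linarith)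
  have hexp : Measurable fun x : ℝ => ENNReal.ofReal (Real.exp (-(a * x))) := by fun_prop
  set Q : Measure ℝ := (volume.restrict (Ioi (0 : ℝ))).withDensity
    fun x => ENNReal.ofReal (Real.exp (-(a * x)))
  have hpos : ∀ᵐ x ∂Q, 0 < x :=
    (withDensity_absolutelyContinuous _ _).ae_le (ae_restrict_mem measurableSet_Ioi)
  have h := lintegral_rpow_neg (P := Q) (X := fun x => x) measurable_id hpos hβ
  have h1 : ∫⁻ x, ENNReal.ofReal (x ^ (-β)) ∂Q =
      ENNReal.ofReal (Real.Gamma (1 - β) * a ^ (β - 1)) := by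
    have h2 := Real.integral_rpow_mul_exp_neg_mul_Ioi (a := 1 - β) (by linarith) ha
    have hint : IntegrableOn (fun x : ℝ => x ^ (1 - β - 1) * Real.exp (-(a * x))) (Ioi 0) := by
      by_contra hc
      rw [integral_undef hc] at h2
      have : 0 < (1 / a) ^ (1 - β) * Real.Gamma (1 - β) := by positivity
      linarith
    have h3 : (1 / a) ^ (1 - β) = a ^ (β - 1) := by
      rw [one_div, Real.inv_rpow ha.le, ← Real.rpow_neg ha.le, neg_sub]
    rw [h3, mul_comm] at h2
    rw [← h2, ofReal_integral_eq_lintegral_ofReal hint,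
      lintegral_withDensity_eq_lintegral_mul _ hexp (by fun_prop)]
    · refine setLIntegral_congr_fun measurableSet_Ioi fun x hx => ?_
      simp only [Pi.mul_apply]
      rw [← ENNReal.ofReal_mul (Real.exp_pos _).le, mul_comm, sub_sub_cancel_left]
    · refine (ae_restrict_iff' measurableSet_Ioi).2 (ae_of_all _ fun γ hγ => ?_)
      have := hγ.out.le
      simp only [Pi.zero_apply]; positivity
  rw [h1, ← ENNReal.ofReal_mul hG.le, ← mul_assoc] at h
  rw [h]
  refine setLIntegral_congr_fun measurableSet_Ioi fun μ hμ => ?_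
  have hμ0 : 0 < μ := hμ
  rw [lintegral_withDensity_eq_lintegral_mul _ hexp (by fun_prop)]
  have h4 : ∫⁻ x in Ioi (0 : ℝ), ((fun x => ENNReal.ofReal (Real.exp (-(a * x)))) *
      fun x => ENNReal.ofReal (Real.exp (-(μ * x)))) x =
      ENNReal.ofReal (1 / (μ + a)) * ∫⁻ s in Ioi (0 : ℝ),
        (Ioi (0 : ℝ)).indicator
          (fun s => ENNReal.ofReal ((μ + a) * Real.exp (-((μ + a) * s)))) s := by
    rw [← lintegral_const_mul _ (Measurable.indicator (by fun_prop) measurableSet_Ioi)]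
    refine setLIntegral_congr_fun measurableSet_Ioi fun x hx => ?_
    have : 0 < μ + a := by positivity
    simp only [Pi.mul_apply, indicator_of_mem hx]
    rw [← ENNReal.ofReal_mul (Real.exp_pos _).le, ← Real.exp_add,
      ← ENNReal.ofReal_mul (by positivity)]
    congr 1
    rw [← mul_assoc, one_div_mul_cancel this.ne', one_mul]
    congr 1
    ring
  rw [h4, lintegral_indicator_exp_neg (by positivity) le_rfl, mul_zero, neg_zero, Real.exp_zero,
    ENNReal.ofReal_one, mul_one, ← ENNReal.ofReal_mul (by positivity), div_eq_mul_one_div]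

lemma integrableOn_rpow_div_add {β a : ℝ} (hβ : 0 < β) (hβ1 : β < 1) (ha : 0 < a) :
    IntegrableOn (fun μ : ℝ => μ ^ (β - 1) / (μ + a)) (Ioi 0) := by
  refine ⟨Measurable.aestronglyMeasurable (by fun_prop), ?_⟩
  rw [hasFiniteIntegral_iff_ofReal, lintegral_rpow_div_add hβ hβ1 ha]
  · exact ENNReal.ofReal_lt_top
  · refine (ae_restrict_iff' measurableSet_Ioi).2 (ae_of_all _ fun γ hγ => ?_)
    have := hγ.out.le
    simp only [Pi.zero_apply]; positivity

lemma integral_rpow_div_add {β a : ℝ} (hβ : 0 < β) (hβ1 : β < 1) (ha : 0 < a) :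
    ∫ μ in Ioi (0 : ℝ), μ ^ (β - 1) / (μ + a) =
      Real.pi / Real.sin (Real.pi * β) * a ^ (β - 1) := by
  have hG := Real.Gamma_pos_of_pos hβ
  have hG1 : 0 < Real.Gamma (1 - β) := Real.Gamma_pos_of_pos (by linarith)
  rw [integral_eq_lintegral_of_nonneg_ae _ (integrableOn_rpow_div_add hβ hβ1 ha).1,
    lintegral_rpow_div_add hβ hβ1 ha, ENNReal.toReal_ofReal (by positivity),
    Real.Gamma_mul_Gamma_one_sub]
  refine (ae_restrict_iff' measurableSet_Ioi).2 (ae_of_all _ fun γ hγ => ?_)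
  have := hγ.out.le
  simp only [Pi.zero_apply]; positivity

/-- The fractional power of `-(1/2) ∂²/∂θ²` acts termwise on trigonometric series. -/
lemma fracPower_tsum_cos {β : ℝ} (hβ : β ∈ Ioc (0 : ℝ) 1) {r δ : ℤ → ℝ} (hr : ∀ k, 0 ≤ r k)
    (hs : Summable r) (hs2 : Summable fun k => r k * (k : ℝ) ^ 2) {φ : ℝ → ℝ}
    (hφ : ∀ θ, φ θ = ∑' k : ℤ, r k * Real.cos (k * θ + δ k)) (θ : ℝ) :
    fracPower β φ θ = ∑' k : ℤ, (r k * ((k : ℝ) ^ 2 / 2) ^ β) * Real.cos (k * θ + δ k) := by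
  have hlap := halfNegLaplacian_tsum_cos hr hs hs2 hφ
  rw [fracPower]
  split_ifs with h1
  · rw [hlap, h1]
    simp only [Real.rpow_one]
  have hβ1 : β < 1 := lt_of_le_of_ne hβ.2 h1
  have hsin : 0 < Real.sin (Real.pi * β) :=
    Real.sin_pos_of_pos_of_lt_pi (mul_pos Real.pi_pos hβ.1) (by nlinarith [Real.pi_pos])
  set ρ : ℤ → ℝ := fun k => r k * ((k : ℝ) ^ 2 / 2) with hρ
  have hρ0 : ∀ k, 0 ≤ ρ k := fun k => mul_nonneg (hr k) (by positivity)
  have hρs : Summable fun k => |ρ k| := by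
    refine (hs2.div_const 2).congr fun k => ?_
    rw [abs_of_nonneg (hρ0 k)]
    simp only [hρ]; ring
  have hlam : ∀ k : ℤ, k ≠ 0 → 0 < (k : ℝ) ^ 2 / 2 := fun k hk => by positivity
  -- The mode `k = 0` needs separate care: its integral `∫ μ^(β-2) dμ` diverges, but `ρ 0 = 0` and
  -- `0 ^ β = 0`, so it contributes nothing to either side.
  have hpow : ∀ k, ρ k * (Real.pi / Real.sin (Real.pi * β) * ((k : ℝ) ^ 2 / 2) ^ (β - 1)) =
      Real.pi / Real.sin (Real.pi * β) * (r k * ((k : ℝ) ^ 2 / 2) ^ β) := by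
    intro k
    rcases eq_or_ne k 0 with rfl | hk
    · simp [hρ, Real.zero_rpow hβ.1.ne']
    · have h2 := hlam k hk
      have h3 : ((k : ℝ) ^ 2 / 2) ^ β = ((k : ℝ) ^ 2 / 2) ^ (β - 1) * ((k : ℝ) ^ 2 / 2) := by
        rw [← Real.rpow_add_one h2.ne', sub_add_cancel]
      rw [h3]
      simp only [hρ]; ring
  set F : ℤ → ℝ → ℝ := fun k μ =>
    ρ k * Real.cos (k * θ + δ k) * (μ ^ (β - 1) / (μ + (k : ℝ) ^ 2 / 2)) with hF
  have hint : ∀ k, IntegrableOn (F k) (Ioi 0) := by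
    intro k
    rcases eq_or_ne k 0 with rfl | hk
    · simp [hF, hρ]
    · exact (integrableOn_rpow_div_add hβ.1 hβ1 (hlam k hk)).const_mul _
  have hval : ∀ k, ∫ μ in Ioi (0 : ℝ), F k μ = Real.pi / Real.sin (Real.pi * β) *
      (r k * ((k : ℝ) ^ 2 / 2) ^ β * Real.cos (k * θ + δ k)) := by
    intro k
    rw [← mul_assoc, ← hpow]
    rcases eq_or_ne k 0 with rfl | hk
    · simp [hF, hρ]
    · simp only [hF]
      rw [integral_const_mul, integral_rpow_div_add hβ.1 hβ1 (hlam k hk)]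
      ring
  have hnorm : ∀ k, ∫ μ in Ioi (0 : ℝ), ‖F k μ‖ ≤ Real.pi / Real.sin (Real.pi * β) *
      (r k * ((k : ℝ) ^ 2 / 2) ^ β) := by
    intro k
    rw [← hpow]
    rcases eq_or_ne k 0 with rfl | hk
    · simp [hF, hρ]
    · have hi := integrableOn_rpow_div_add hβ.1 hβ1 (hlam k hk)
      rw [← integral_rpow_div_add hβ.1 hβ1 (hlam k hk), ← integral_const_mul]
      refine setIntegral_mono_on (hint k).norm (hi.const_mul _) measurableSet_Ioi fun μ hμ => ?_
      have h0 : 0 ≤ μ ^ (β - 1) / (μ + (k : ℝ) ^ 2 / 2) := by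
        have := hμ.out.le; positivity
      simp only [hF]
      rw [norm_mul, norm_mul, Real.norm_of_nonneg h0, Real.norm_of_nonneg (hρ0 k)]
      refine mul_le_mul_of_nonneg_right ?_ h0
      exact mul_le_of_le_one_right (hρ0 k) (Real.abs_cos_le_one _)
  have hsβ : Summable fun k : ℤ => r k * ((k : ℝ) ^ 2 / 2) ^ β :=
    summable_mul_rpow hβ hr hs hs2
  have hsum := hasSum_integral_of_summable_integral_norm hint
    (Summable.of_nonneg_of_le (fun k => integral_nonneg fun _ => norm_nonneg _) hnorm
      (hsβ.mul_left _))
  have h5 : ∫ μ in Ioi (0 : ℝ), μ ^ (β - 1) * greenResolvent μ (halfNegLaplacian φ) θ =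
      ∫ μ in Ioi (0 : ℝ), ∑' k, F k μ := by
    refine setIntegral_congr_fun measurableSet_Ioi fun μ hμ => ?_
    rw [greenResolvent_tsum_cos hρs hlap hμ, ← tsum_mul_left]
    refine tsum_congr fun k => ?_
    simp only [hF]; ring
  rw [h5, ← hsum.tsum_eq, ← tsum_mul_left]
  refine tsum_congr fun k => ?_
  rw [hval]
  have := Real.pi_pos
  field_simp

end Resolvent

/-! ### The Cauchy problem -/

section Cauchy

variable {Ω : Type*} [MeasurableSpace Ω] {P : Measure Ω} [IsProbabilityMeasure P] {β ν : ℝ}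

namespace IsMLTime

variable {T : Ω → ℝ≥0} {t : ℝ}

lemma density_nonneg (hT : IsMLTime ν β t T P) (hpos : ∀ᵐ ω ∂P, 0 < T ω) {θ : ℝ}
    (hθ : θ ∈ Ioo 0 (2 * Real.pi)) : 0 ≤ density ν β θ t := by
  rw [hT.density_eq hpos hθ]
  exact integral_nonneg fun ω => wrappedGaussian_nonneg _ _

lemma ae_density_nonneg (hT : IsMLTime ν β t T P) (hpos : ∀ᵐ ω ∂P, 0 < T ω) :
    ∀ᵐ θ ∂(volume.restrict (Ico (0 : ℝ) (2 * Real.pi))), 0 ≤ density ν β θ t := by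
  rw [← restrict_Ioo_eq_restrict_Ico]
  exact (ae_restrict_iff' measurableSet_Ioo).2 (ae_of_all _ fun θ hθ => hT.density_nonneg hpos hθ)

lemma aemeasurable_density (hT : IsMLTime ν β t T P) (hpos : ∀ᵐ ω ∂P, 0 < T ω) :
    AEMeasurable (fun θ => density ν β θ t) (volume.restrict (Ico (0 : ℝ) (2 * Real.pi))) := by
  have hm : Measurable fun θ : ℝ =>
      (∫⁻ ω, ∑' n : ℤ, gaussianPDF 0 (T ω) (θ + 2 * Real.pi * n) ∂P).toReal :=
    (Measurable.lintegral_prod_right' (f := fun p : ℝ × Ω =>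
      ∑' n : ℤ, gaussianPDF 0 (T p.2) (p.1 + 2 * Real.pi * n))
      (measurable_wrappedGaussian.comp
        ((hT.measurable.comp measurable_snd).prodMk measurable_fst))).ennreal_toReal
  refine ⟨_, hm, ?_⟩
  filter_upwards [hT.ae_ofReal_density hpos, hT.ae_density_nonneg hpos] with θ h1 h2
  rw [← h1, ENNReal.toReal_ofReal h2]

/-- The pairing of the density with a trigonometric series. -/
lemma pairing_tsum_cos (hT : IsMLTime ν β t T P) (hpos : ∀ᵐ ω ∂P, 0 < T ω)
    {B : ℝ≥0 → Ω → ℝ} (hBm : ∀ t, Measurable (B t)) (hB : IsBrownianReal B P)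
    (hind : IndepFun (fun ω s => B s ω) T P) {r δ : ℤ → ℝ} (hr : Summable fun k => |r k|)
    {f : ℝ → ℝ} (hf : ∀ θ, f θ = ∑' k : ℤ, r k * Real.cos (k * θ + δ k)) :
    pairing (density ν β) f t =
      ∑' k : ℤ, r k * Real.cos (δ k) * mittagLeffler ν (-(((k : ℝ) ^ 2 / 2) ^ β * t ^ ν)) := by
  have hX := hT.hasLaw_wrap hpos hBm hB hind
  rw [funext hf, pairing_density_eq hX (hT.aemeasurable_density hpos) (hT.ae_density_nonneg hpos)
    (continuous_tsum_cos hr)]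
  exact integral_tsum_cos hX.aemeasurable hr (hT.integral_cos_wrap hBm hB hind)

end IsMLTime

/-- The Cauchy problem, given the random time at every `t > 0`. -/
lemma solvesCauchyProblem_density (hβ : β ∈ Ioc (0 : ℝ) 1) (hν : ν ∈ Ioc (0 : ℝ) 1)
    (hE : MittagLefflerBounds ν) {B : ℝ≥0 → Ω → ℝ} (hBm : ∀ t, Measurable (B t))
    (hB : IsBrownianReal B P)
    (hT : ∀ t : ℝ, 0 < t → ∃ T : Ω → ℝ≥0, IsMLTime ν β t T P ∧ (∀ᵐ ω ∂P, 0 < T ω) ∧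
      IndepFun (fun ω s => B s ω) T P) :
    SolvesCauchyProblem ν β (density ν β) := by
  refine ⟨fun t ht => ?_, fun φ hφ hp => ?_⟩
  · obtain ⟨T, hT, hpos, hind⟩ := hT t ht
    exact intervalIntegrable_density (hT.hasLaw_wrap hpos hBm hB hind)
      (hT.aemeasurable_density hpos) (hT.ae_density_nonneg hpos)
  obtain ⟨r, δ, hr, hs, hs2, hφr⟩ := exists_tsum_cos hφ hp
  have hsβ := summable_mul_rpow hβ hr hs hs2
  have hl : ∀ k : ℤ, 0 ≤ ((k : ℝ) ^ 2 / 2) ^ β := fun k => by positivity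
  have hb : ∀ k, |r k * Real.cos (δ k)| ≤ r k := fun k => by
    rw [abs_mul, abs_of_nonneg (hr k)]
    exact mul_le_of_le_one_right (hr k) (Real.abs_cos_le_one _)
  have hbs : Summable fun k => |r k * Real.cos (δ k)| :=
    hs.of_nonneg_of_le (fun _ => abs_nonneg _) hb
  have hbl : Summable fun k : ℤ => |r k * Real.cos (δ k)| * ((k : ℝ) ^ 2 / 2) ^ β :=
    hsβ.of_nonneg_of_le (fun k => mul_nonneg (abs_nonneg _) (hl k))
      fun k => mul_le_mul_of_nonneg_right (hb k) (hl k)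
  have hu : ∀ t, 0 < t → pairing (density ν β) φ t = ∑' k : ℤ,
      r k * Real.cos (δ k) * mittagLeffler ν (-(((k : ℝ) ^ 2 / 2) ^ β * t ^ ν)) := fun t ht => by
    obtain ⟨T, hT, hpos, hind⟩ := hT t ht
    exact hT.pairing_tsum_cos hpos hBm hB hind hs.abs hφr
  refine ⟨fun t ht => ?_, ?_⟩
  · obtain ⟨T, hT, hpos, hind⟩ := hT t ht
    rw [hT.pairing_tsum_cos hpos hBm hB hind hsβ.abs (fracPower_tsum_cos hβ hr hs hs2 hφr)]
    convert hasCaputoDeriv_tsum_mittagLeffler hν hE hl hbs hbl hu ht using 5 with k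
    ring
  · have h0 : φ 0 = ∑' k, r k * Real.cos (δ k) := by simpa using hφr 0
    rw [h0]
    refine (tendsto_tsum_mittagLeffler hν.1 hE hl hbs).congr' ?_
    filter_upwards [self_mem_nhdsWithin] with t ht
    exact (hu t ht).symm

/-- The `1/x` decay bounds the coefficients by a multiple of `k^(-2β)`. The index is shifted because
that decay says nothing at `k = 0`, where the argument vanishes. -/
lemma summable_mittagLeffler_sq_rpow {K : ℝ≥0 → Ω → ℝ≥0} (hK : IsStableSubordinator ν K P)
    (hν : 0 < ν) (hβ : 1 / 2 < β) {t : ℝ≥0} (ht : 0 < t) :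
    Summable fun k : ℕ => mittagLeffler ν (-(((k : ℝ) ^ 2 / 2) ^ β * (t : ℝ) ^ ν)) := by
  have h := (summable_nat_add_iff 1).2 ((summable_inv_rpow hβ).mul_left (1 - Real.exp (-t))⁻¹)
  refine (summable_nat_add_iff 1).1 (h.of_nonneg_of_le
    (fun k => (hK.mittagLefflerBounds hν).nonneg _) fun k => ?_)
  exact hK.mittagLeffler_neg_le hν ht (by positivity)

end Cauchy

end CircleFrac

/-! ### The main theorem -/

theorem mainTheorem7 {Ω : Type*} [MeasurableSpace Ω] (P : Measure Ω) [IsProbabilityMeasure P]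
    (β ν : ℝ) (hβ : β ∈ Ioc (0 : ℝ) 1) (hν : ν ∈ Ioc (0 : ℝ) 1)
    (B : ℝ≥0 → Ω → ℝ) (H K : ℝ≥0 → Ω → ℝ≥0)
    (hBm : ∀ t, Measurable (B t)) (hB : IsBrownianReal B P)
    (hH : CircleFrac.IsStableSubordinator β H P) (hK : CircleFrac.IsStableSubordinator ν K P)
    (hind : iIndepFun (β := fun _ : Fin 3 => ℝ≥0 → ℝ)
      ![fun ω t => B t ω, fun ω t => (H t ω : ℝ), fun ω t => (K t ω : ℝ)] P) :
    (∀ t : ℝ, 0 < t → ∀ θ ∈ Ico (0 : ℝ) (2 * Real.pi), (θ ≠ 0 ∨ ν = 1 ∨ 1 / 2 < β) →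
      Tendsto (CircleFrac.densityPartialSum ν β θ t) atTop (𝓝 (CircleFrac.density ν β θ t)) ∧
      0 ≤ CircleFrac.density ν β θ t) ∧
    (∀ t : ℝ≥0, 0 < t →
      HasLaw
        (fun ω => CircleFrac.wrap B (H (CircleFrac.inverseSubordinator K t ω) ω) ω)
        ((volume.restrict (Ico (0 : ℝ) (2 * Real.pi))).withDensity
          fun θ => ENNReal.ofReal (CircleFrac.density ν β θ t)) P) ∧
    CircleFrac.SolvesCauchyProblem ν β (CircleFrac.density ν β) := by
  have hE := hK.mittagLefflerBounds hν.1
  have hT : ∀ t : ℝ≥0, 0 < t → ∃ T : Ω → ℝ≥0, CircleFrac.IsMLTime ν β t T P ∧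
      (∀ᵐ ω ∂P, 0 < T ω) ∧ IndepFun (fun ω s => B s ω) T P ∧
      ∀ᵐ ω ∂P, T ω = H (CircleFrac.inverseSubordinator K t ω) ω := by
    intro t ht
    obtain ⟨T, hTm, hTe, hTi, hTl⟩ := CircleFrac.exists_randomTime hν.1 hBm hH hK hind ht
    have h : CircleFrac.IsMLTime ν β t T P := ⟨hTm, hTl⟩
    exact ⟨T, h, h.ae_pos hβ.1 (NNReal.coe_pos.2 ht) hE, hTi, hTe⟩
  refine ⟨fun t ht θ hθ hor => ?_, fun t ht => ?_, ?_⟩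
  · lift t to ℝ≥0 using ht.le
    rcases eq_or_ne θ 0 with rfl | hne
    · refine CircleFrac.tendsto_densityPartialSum_zero hE ?_
      rcases hor with h | rfl | h
      · exact absurd rfl h
      · simp only [CircleFrac.mittagLeffler_one]
        exact CircleFrac.summable_exp_neg_rpow hβ.1 (Real.rpow_pos_of_pos ht 1)
      · exact CircleFrac.summable_mittagLeffler_sq_rpow hK hν.1 h (NNReal.coe_pos.1 ht)
    · have hθ' : θ ∈ Ioo 0 (2 * Real.pi) := ⟨hθ.1.lt_of_ne hne.symm, hθ.2⟩
      obtain ⟨T, hT, hpos, -, -⟩ := hT t (NNReal.coe_pos.1 ht)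
      refine ⟨?_, hT.density_nonneg hpos hθ'⟩
      rw [hT.density_eq hpos hθ']
      exact hT.tendsto_densityPartialSum hpos hθ'
  · obtain ⟨T, hT, hpos, hTi, hTe⟩ := hT t ht
    refine (hT.hasLaw_wrap hpos hBm hB hTi).congr ?_
    filter_upwards [hTe] with ω hω
    rw [hω]
  · refine CircleFrac.solvesCauchyProblem_density hβ hν hE hBm hB fun t ht => ?_
    lift t to ℝ≥0 using ht.le
    obtain ⟨T, hT, hpos, hTi, -⟩ := hT t (NNReal.coe_pos.1 ht)
    exact ⟨T, hT, hpos, hTi⟩
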